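/- Let $P$ be a convex polygon in the Euclidean plane $\mathbb{R}^2$, regarded as a convex closed polygonal chain (the boundary of the convex hull of its vertices), with exactly $n\ge 2$ vertices; for $n=2$, $P$ is a nondegenerate line segment. Let $L(P)$ be the perimeter of $P$ (for $n=2$, twice the length of the segment), and let $\delta(P)=\inf_{p\in P}\sup_{q\in P}|p-q|$ be the relative Chebyshev radius of $P$. Then $$L(P)\le 2\left(1+(n-1)\sin\left(\frac{\pi}{2(n-1)}\right)\right)\cdot\delta(P).$$ For $r>0$ let $U_n(r)$ be the closed polygonal chain with successive vertices $r\left(\cos\frac{k\pi}{n-1},\sin\frac{k\pi}{n-1}\right)$, $k=0,1,\dots,n-1$; that is, a diameter of a circle of radius $r$ together with the half, on one side of this diameter, of the regular $2(n-1)$-gon inscribed in the circle and having the ends of the diameter among its vertices. Each $U_n(r)$ is a convex $n$-gon, and equality holds in the inequality if and only if $P$ is congruent to $U_n(r)$ for some $r>0$. -/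

import Mathlib

/-- The Euclidean plane `ℝ²` with its standard Euclidean metric. -/
abbrev Plane : Type := EuclideanSpace ℝ (Fin 2)

/-- The relative Chebyshev radius `δ(X) = inf_{p ∈ X} sup_{q ∈ X} d(p, q)` of a (bounded) subset
`X` of a metric space with respect to `X` itself. -/
noncomputable def relChebyshevRadius {α : Type*} [MetricSpace α] (X : Set α) : ℝ :=
  ⨅ p : X, ⨆ q : X, dist (p : α) (q : α)

/-- The closed polygonal chain `v 0, v 1, …, v (n - 1), v 0`, as a subset of the plane
(`finRotate n i` is the cyclic successor of `i`). -/
def polygonalChain {n : ℕ} (v : Fin n → Plane) : Set Plane :=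
  ⋃ i : Fin n, segment ℝ (v i) (v (finRotate n i))

/-- The length of the closed polygonal chain with vertices `v 0, …, v (n - 1)`. For `n = 2` both
summands are the length of the segment, so this is the doubled length of the segment. -/
noncomputable def perimeter {n : ℕ} (v : Fin n → Plane) : ℝ :=
  ∑ i : Fin n, dist (v i) (v (finRotate n i))

/-- `v` lists, in cyclic order, the vertices of a convex `n`-gon: the `n` points `v i` are
distinct, each of them is a genuine vertex (an extreme point of the convex hull), and the closed
polygonal chain through them is the boundary of their convex hull. For `n = 2` this is a
nondegenerate line segment. -/
structure IsConvexNgon {n : ℕ} (v : Fin n → Plane) : Prop where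
  injective : Function.Injective v
  extreme : ∀ i, v i ∈ (convexHull ℝ (Set.range v)).extremePoints ℝ
  chain_eq : polygonalChain v = frontier (convexHull ℝ (Set.range v))

/-- The vertices `r (cos (kπ/(n-1)), sin (kπ/(n-1)))`, `k = 0, …, n - 1`, of the polygon `U_n` of
size `r`. These are the vertices in the closed upper half-plane of the regular `2(n-1)`-gon
inscribed in the circle of radius `r` about the origin that has `(r, 0)` and `(-r, 0)` among its
vertices; the closing side, from `k = n - 1` to `k = 0`, is the diameter from `(-r, 0)`
to `(r, 0)`. -/
noncomputable def halfRegularVertices (n : ℕ) (r : ℝ) : Fin n → Plane := fun k =>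
  !₂[r * Real.cos ((k : ℕ) * Real.pi / ((n : ℝ) - 1)),
     r * Real.sin ((k : ℕ) * Real.pi / ((n : ℝ) - 1))]

/-!
Why the inequality holds. Let `p` be a point of the polygon from which all of it lies within
distance `r = δ(P)`. The point `p` lies on some side, and the line through that side supports the
convex polygon, so `P` lies in a half disc `H` of radius `r` about `p` whose diameter contains
a side of `P`.

Put `N = n - 1`. Let `u₀, …, u_N` be the unit directions of the sides, where `u_N = e₁` is the
direction of the side on the diameter, and let `c_i = u_{i-1} - u_i`, with indices modulo
`n`. Summation by parts
(`sum_inner_sub_eq`) writes the perimeter as the linear form `∑ ⟪v_i, c_i⟫` in the vertices. Each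
`v_i` lies in `H`, so the sum grows if `v_i` is replaced by a point `w_i` of `H` that is extremal
in direction `c_i`; such a point lies on the half circle, at the angle of `c_i` clamped to `[0, π]`
(`halfDisc_support`). Summing by parts back, the result is `∑ ⟪w_{i+1} - w_i, u_i⟫`, which is at
most the perimeter of the chain of the `w_i`. As the sides of a convex polygon turn monotonically,
the angles of `w_0, …, w_N` increase, so Jensen's inequality for the sine (`sum_sin_half_le`)
bounds their chords by `2 r N sin (π / (2 N))`, and the closing side is at most `2 r`. This is
`halfDisc_chain_le`. In the case of equality the `w_i` are equally spaced on the half circle, which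
fixes the directions `u_i`, hence the nonzero `c_i`, and then `v_i = w_i`.

Conversely, the perimeter of a convex polygon only depends on its point set, since it is the
one-dimensional Hausdorff measure of the set, doubled for `n = 2`
(`IsConvexNgon.perimeter_eq_hausdorffMeasure`). So a polygon congruent to `U_n(r)` has the perimeter
of `U_n(r)`. The radius `δ(U_n(r))` is at most `r` because of the midpoint of the diameter, and at
least `r` by the inequality itself.
-/

/-! ### Directions, half discs and sums of sines -/

/-- Polar coordinates with the angle in `[0, 2π)`. -/
lemma exists_polar_angle (a b : ℝ) :
    ∃ ψ : ℝ, 0 ≤ ψ ∧ ψ < 2 * Real.pi ∧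
      a = √(a ^ 2 + b ^ 2) * Real.cos ψ ∧ b = √(a ^ 2 + b ^ 2) * Real.sin ψ := by
  have hn : ‖(⟨a, b⟩ : ℂ)‖ = √(a ^ 2 + b ^ 2) := by
    rw [Complex.norm_def, Complex.normSq_mk]; ring_nf
  have h1 := Complex.norm_mul_cos_arg ⟨a, b⟩
  have h2 := Complex.norm_mul_sin_arg ⟨a, b⟩
  rw [hn] at h1 h2
  have h3 := Complex.arg_le_pi ⟨a, b⟩
  have h4 := Complex.neg_pi_lt_arg ⟨a, b⟩
  have hpi := Real.pi_pos
  rcases le_or_gt 0 (Complex.arg ⟨a, b⟩) with h | h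
  · exact ⟨_, h, by linarith, h1.symm, h2.symm⟩
  · refine ⟨Complex.arg ⟨a, b⟩ + 2 * Real.pi, by linarith, by linarith, ?_, ?_⟩
    · rw [Real.cos_add_two_pi]; exact h1.symm
    · rw [Real.sin_add_two_pi]; exact h2.symm

/-- The angle in `[0, π]` of the point of the upper half of a circle that is extremal in the
direction of angle `φ ∈ [-π/2, 3π/2]`. -/
noncomputable def clampAngle (φ : ℝ) : ℝ := max 0 (min φ Real.pi)

lemma clampAngle_nonneg (φ : ℝ) : 0 ≤ clampAngle φ := le_max_left _ _

lemma clampAngle_le_pi (φ : ℝ) : clampAngle φ ≤ Real.pi :=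
  max_le Real.pi_pos.le (min_le_right _ _)

lemma clampAngle_mono : Monotone clampAngle := fun _ _ h =>
  max_le_max le_rfl (min_le_min h le_rfl)

lemma clampAngle_of_mem {φ : ℝ} (h : 0 < clampAngle φ) (h' : clampAngle φ < Real.pi) :
    clampAngle φ = φ := by
  unfold clampAngle at *
  rcases le_total φ Real.pi with h1 | h1
  · rw [min_eq_left h1] at *
    rcases le_total 0 φ with h2 | h2
    · exact max_eq_right h2
    · rw [max_eq_left h2] at h; exact absurd h (lt_irrefl _)
  · rw [min_eq_right h1, max_eq_right Real.pi_pos.le] at h'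
    exact absurd h' (lt_irrefl _)

lemma mul_cos_add_mul_sin_le {r x y : ℝ} (hr : 0 ≤ r) (h : x ^ 2 + y ^ 2 ≤ r ^ 2) (φ : ℝ) :
    x * Real.cos φ + y * Real.sin φ ≤ r := by
  have := Real.sin_sq_add_cos_sq φ
  refine abs_le_of_sq_le_sq' ?_ hr |>.2
  nlinarith [sq_nonneg (x * Real.sin φ - y * Real.cos φ), sq_nonneg x, sq_nonneg y]

/-- Among the points of a half disc, the one of angle `clampAngle φ` on the circle is extremal in
direction `φ`. -/
lemma halfDisc_support {r x y φ : ℝ} (hr : 0 ≤ r) (h : x ^ 2 + y ^ 2 ≤ r ^ 2) (hy : 0 ≤ y)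
    (h1 : -(Real.pi / 2) ≤ φ) (h2 : φ ≤ 3 * Real.pi / 2) :
    x * Real.cos φ + y * Real.sin φ ≤
      r * Real.cos (clampAngle φ) * Real.cos φ + r * Real.sin (clampAngle φ) * Real.sin φ := by
  have hpi := Real.pi_pos
  have hx := abs_le_of_sq_le_sq' (by nlinarith [sq_nonneg y] : x ^ 2 ≤ r ^ 2) hr
  unfold clampAngle
  rcases lt_or_ge φ 0 with h0 | h0
  · rw [min_eq_left (by linarith), max_eq_left h0.le]
    have hs : Real.sin φ ≤ 0 := Real.sin_nonpos_of_nonpos_of_neg_pi_le h0.le (by linarith)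
    have hc : 0 ≤ Real.cos φ := Real.cos_nonneg_of_neg_pi_div_two_le_of_le h1 (by linarith)
    simp only [Real.cos_zero, Real.sin_zero]
    nlinarith
  rcases le_or_gt φ Real.pi with hp | hp
  · rw [min_eq_left hp, max_eq_right h0]
    have := mul_cos_add_mul_sin_le hr h φ
    have := Real.sin_sq_add_cos_sq φ
    nlinarith
  · rw [min_eq_right hp.le, max_eq_right hpi.le]
    have hs : 0 ≤ Real.sin (φ - Real.pi) :=
      Real.sin_nonneg_of_nonneg_of_le_pi (by linarith) (by linarith)
    have hc : 0 ≤ Real.cos (φ - Real.pi) :=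
      Real.cos_nonneg_of_neg_pi_div_two_le_of_le (by linarith) (by linarith)
    rw [Real.sin_sub_pi] at hs
    rw [Real.cos_sub_pi] at hc
    simp only [Real.cos_pi, Real.sin_pi]
    nlinarith

lemma cos_sub_cos_eq (α β : ℝ) : Real.cos α - Real.cos β =
    2 * Real.sin ((β - α) / 2) * Real.cos ((α + β) / 2 - Real.pi / 2) := by
  rw [Real.cos_sub_cos, Real.cos_sub_pi_div_two,
    show (α - β) / 2 = -((β - α) / 2) by ring, Real.sin_neg]
  ring

lemma sin_sub_sin_eq (α β : ℝ) : Real.sin α - Real.sin β =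
    2 * Real.sin ((β - α) / 2) * Real.sin ((α + β) / 2 - Real.pi / 2) := by
  rw [Real.sin_sub_sin, Real.sin_sub_pi_div_two,
    show (α - β) / 2 = -((β - α) / 2) by ring, Real.sin_neg]
  ring

/-- Summation by parts. -/
lemma sum_inner_sub_eq (X Y C S : ℕ → ℝ) (N : ℕ) :
    ∑ i ∈ Finset.range (N + 1), (X i * (C i - C (i + 1)) + Y i * (S i - S (i + 1))) =
      X 0 * C 0 + Y 0 * S 0 - (X N * C (N + 1) + Y N * S (N + 1)) +
        ∑ i ∈ Finset.range N,
          ((X (i + 1) - X i) * C (i + 1) + (Y (i + 1) - Y i) * S (i + 1)) := by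
  induction N with
  | zero => simp; ring
  | succ N ih => rw [Finset.sum_range_succ, ih, Finset.sum_range_succ]; ring

/-- The projection of a chord of a circle to any direction is at most the length of the chord. -/
lemma chord_inner_le {r α β : ℝ} (hr : 0 ≤ r) (h : α ≤ β) (h' : β - α ≤ 2 * Real.pi) (ψ : ℝ) :
    (r * Real.cos β - r * Real.cos α) * Real.cos ψ + (r * Real.sin β - r * Real.sin α) * Real.sin ψ
      ≤ 2 * r * Real.sin ((β - α) / 2) := by
  have hs : 0 ≤ Real.sin ((β - α) / 2) :=
    Real.sin_nonneg_of_nonneg_of_le_pi (by linarith) (by linarith)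
  have h1 := cos_sub_cos_eq α β
  have h2 := sin_sub_sin_eq α β
  set m := (α + β) / 2 - Real.pi / 2
  have h3 : -(Real.cos m * Real.cos ψ + Real.sin m * Real.sin ψ) ≤ 1 := by
    rw [← Real.cos_sub]; linarith [Real.neg_one_le_cos (m - ψ)]
  calc _ = 2 * r * Real.sin ((β - α) / 2) *
        -(Real.cos m * Real.cos ψ + Real.sin m * Real.sin ψ) := by
        linear_combination (-r * Real.cos ψ) * h1 + (-r * Real.sin ψ) * h2
    _ ≤ 2 * r * Real.sin ((β - α) / 2) * 1 := by gcongr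
    _ = _ := mul_one _

lemma sin_pi_div_two_mul_nonneg {N : ℕ} (hN : 0 < N) : 0 ≤ Real.sin (Real.pi / (2 * N)) := by
  have h : (1 : ℝ) ≤ N := by exact_mod_cast hN
  exact Real.sin_nonneg_of_nonneg_of_le_pi (div_nonneg Real.pi_pos.le (by positivity))
    (div_le_self Real.pi_pos.le (by linarith))

/-- Jensen's inequality for the half-angles of a subdivision of an angle at most `π`. -/
lemma sum_sin_half_le {N : ℕ} (hN : 0 < N) {d : ℕ → ℝ} (hd : ∀ i < N, 0 ≤ d i)
    (hs : ∑ i ∈ Finset.range N, d i ≤ Real.pi) :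
    ∑ i ∈ Finset.range N, Real.sin (d i / 2) ≤ N * Real.sin (Real.pi / (2 * N)) ∧
      (∑ i ∈ Finset.range N, Real.sin (d i / 2) = N * Real.sin (Real.pi / (2 * N)) →
        ∀ i < N, d i = Real.pi / N) := by
  have hpi := Real.pi_pos
  have hN0 : (0 : ℝ) < N := by exact_mod_cast hN
  have hN1 : (1 : ℝ) ≤ N := by exact_mod_cast hN
  have hmem : ∀ i ∈ Finset.range N, d i / 2 ∈ Set.Icc 0 Real.pi := by
    intro i hi
    have h1 := Finset.single_le_sum (fun j hj => hd j (Finset.mem_range.1 hj)) hi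
    have h2 := hd i (Finset.mem_range.1 hi)
    exact ⟨by linarith, by linarith⟩
  have hw : ∀ i ∈ Finset.range N, (0 : ℝ) < 1 / N := fun _ _ => by positivity
  have hw1 : ∑ i ∈ Finset.range N, (1 : ℝ) / N = 1 := by simp; field_simp
  have hJ := strictConcaveOn_sin_Icc.concaveOn.le_map_sum (fun i hi => (hw i hi).le) hw1 hmem
  have hJe := fun h => strictConcaveOn_sin_Icc.eq_of_map_sum_eq hw hw1 hmem h
  simp only [smul_eq_mul, ← Finset.mul_sum, ← Finset.sum_div] at hJ hJe
  set D := ∑ i ∈ Finset.range N, d i with hD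
  have hD0 : 0 ≤ D := Finset.sum_nonneg fun j hj => hd j (Finset.mem_range.1 hj)
  have hA : 1 / (N : ℝ) * (D / 2) = D / (2 * N) := by field_simp
  rw [hA] at hJ hJe
  have hle : D / (2 * N) ≤ Real.pi / (2 * N) := by gcongr
  have hle2 : Real.pi / (2 * N) ≤ Real.pi / 2 := by
    apply div_le_div_of_nonneg_left hpi.le (by norm_num); linarith
  have hnn : 0 ≤ D / (2 * N) := by positivity
  have hm : Real.sin (D / (2 * N)) ≤ Real.sin (Real.pi / (2 * N)) :=
    Real.sin_le_sin_of_le_of_le_pi_div_two (by linarith) hle2 hle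
  set T := ∑ i ∈ Finset.range N, Real.sin (d i / 2)
  have hT : 1 / (N : ℝ) * T = T / N := by ring
  rw [hT] at hJ hJe
  refine ⟨?_, fun he i hi => ?_⟩
  · have := (div_le_iff₀ hN0).1 (hJ.trans hm); linarith
  · have he' : T / N = Real.sin (Real.pi / (2 * N)) := by rw [he]; field_simp
    have hall := hJe (by rw [he']; exact hm)
    have heq : Real.sin (D / (2 * N)) = Real.sin (Real.pi / (2 * N)) :=
      le_antisymm hm (by rw [← he']; exact hJ)
    have hinj := Real.injOn_sin ⟨by linarith, by linarith⟩ ⟨by linarith, by linarith⟩ heq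
    have hDpi : D = Real.pi := by field_simp at hinj; exact hinj
    have hDN : D = N * d i := by
      rw [hD, Finset.sum_congr rfl (fun j hj => ?_), Finset.sum_const, Finset.card_range,
        nsmul_eq_mul]
      have := hall hj (Finset.mem_range.2 hi)
      linarith
    rw [← hDpi, hDN]; field_simp

/-- The equality case of `chord_inner_le`: the direction is that of the chord. -/
lemma direction_of_chord_inner_eq {r α β ψ : ℝ} (hr : 0 < r) (h : α < β) (h' : β - α < 2 * Real.pi)
    (he : (r * Real.cos β - r * Real.cos α) * Real.cos ψ +
      (r * Real.sin β - r * Real.sin α) * Real.sin ψ = 2 * r * Real.sin ((β - α) / 2)) :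
    Real.cos ψ = -Real.sin ((α + β) / 2) ∧ Real.sin ψ = Real.cos ((α + β) / 2) := by
  have hs : 0 < Real.sin ((β - α) / 2) :=
    Real.sin_pos_of_pos_of_lt_pi (by linarith) (by linarith)
  have h1 := cos_sub_cos_eq α β
  have h2 := sin_sub_sin_eq α β
  rw [Real.cos_sub_pi_div_two] at h1
  rw [Real.sin_sub_pi_div_two] at h2
  set m := (α + β) / 2
  have hk : 2 * r * Real.sin ((β - α) / 2) *
      (-Real.sin m * Real.cos ψ + Real.cos m * Real.sin ψ - 1) = 0 := by
    linear_combination he + (r * Real.cos ψ) * h1 + (r * Real.sin ψ) * h2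
  have hk' : -Real.sin m * Real.cos ψ + Real.cos m * Real.sin ψ = 1 := by
    rcases mul_eq_zero.1 hk with h0 | h0
    · exact absurd h0 (by positivity)
    · linarith
  have e1 := Real.sin_sq_add_cos_sq m
  have e2 := Real.sin_sq_add_cos_sq ψ
  have hz : (Real.cos ψ + Real.sin m) ^ 2 + (Real.sin ψ - Real.cos m) ^ 2 = 0 := by nlinarith
  constructor
  · nlinarith [sq_nonneg (Real.cos ψ + Real.sin m), sq_nonneg (Real.sin ψ - Real.cos m)]
  · nlinarith [sq_nonneg (Real.cos ψ + Real.sin m), sq_nonneg (Real.sin ψ - Real.cos m)]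

lemma eq_of_mul_cos_add_mul_sin_eq {r x y φ : ℝ} (h : x ^ 2 + y ^ 2 ≤ r ^ 2)
    (he : x * Real.cos φ + y * Real.sin φ = r) : x = r * Real.cos φ ∧ y = r * Real.sin φ := by
  have e1 := Real.sin_sq_add_cos_sq φ
  have hz : (x - r * Real.cos φ) ^ 2 + (y - r * Real.sin φ) ^ 2 ≤ 0 := by
    have : (x - r * Real.cos φ) ^ 2 + (y - r * Real.sin φ) ^ 2 =
      x ^ 2 + y ^ 2 - 2 * r * (x * Real.cos φ + y * Real.sin φ) +
        r ^ 2 * (Real.sin φ ^ 2 + Real.cos φ ^ 2) := by ring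
    rw [this, he, e1]; linarith
  constructor
  · nlinarith [sq_nonneg (x - r * Real.cos φ), sq_nonneg (y - r * Real.sin φ)]
  · nlinarith [sq_nonneg (x - r * Real.cos φ), sq_nonneg (y - r * Real.sin φ)]

/-! ### Polygons in a half disc -/

set_option maxHeartbeats 1000000 in
/-- The estimate for a polygon in a half disc whose sides turn monotonically. The sides have length
`ℓ i` and direction angle `Ψ (i + 1)`; the side from the last vertex to the first one lies on
the diameter, and its direction angle is `Ψ 0 = 0`, counted as `Ψ (N + 1) = 2π` after one turn. -/
lemma halfDisc_chain_le {N : ℕ} (hN : 0 < N) {r : ℝ} (hr : 0 ≤ r) {x y Ψ ℓ : ℕ → ℝ}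
    (hΨ0 : Ψ 0 = 0) (hΨN : Ψ (N + 1) = 2 * Real.pi) (hΨ : ∀ i ≤ N, Ψ i ≤ Ψ (i + 1))
    (hx : ∀ i < N, x (i + 1) - x i = ℓ i * Real.cos (Ψ (i + 1)))
    (hy : ∀ i < N, y (i + 1) - y i = ℓ i * Real.sin (Ψ (i + 1)))
    (hdisc : ∀ i ≤ N, x i ^ 2 + y i ^ 2 ≤ r ^ 2) (hpos : ∀ i ≤ N, 0 ≤ y i)
    (hy0 : y 0 = 0) (hyN : y N = 0) :
    x 0 - x N + ∑ i ∈ Finset.range N, ℓ i ≤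
        2 * (1 + N * Real.sin (Real.pi / (2 * N))) * r ∧
      (0 < r → x 0 - x N + ∑ i ∈ Finset.range N, ℓ i =
          2 * (1 + N * Real.sin (Real.pi / (2 * N))) * r →
        ∀ i ≤ N, x i = r * Real.cos (i * Real.pi / N) ∧ y i = r * Real.sin (i * Real.pi / N)) := by
  have hpi := Real.pi_pos
  have hN0 : (0 : ℝ) < N := by exact_mod_cast hN
  -- Only `Ψ 0, …, Ψ (N + 1)` matter: bounds follow from monotonicity.
  have hmono : ∀ j ≤ N + 1, ∀ i ≤ j, Ψ i ≤ Ψ j := by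
    intro j
    induction j with
    | zero => intro _ i hi; rw [Nat.le_zero.1 hi]
    | succ j ih =>
      intro hj i hi
      rcases Nat.lt_or_ge j i with h | h
      · rw [show i = j + 1 by omega]
      · exact (ih (by omega) i h).trans (hΨ j (by omega))
  have hΨnn : ∀ i ≤ N + 1, 0 ≤ Ψ i := fun i hi => hΨ0 ▸ hmono i hi 0 (Nat.zero_le _)
  have hΨle : ∀ i ≤ N + 1, Ψ i ≤ 2 * Real.pi := fun i hi => hΨN ▸ hmono (N + 1) le_rfl i hi
  set φ : ℕ → ℝ := fun i => (Ψ i + Ψ (i + 1)) / 2 - Real.pi / 2 with hφ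
  set θ : ℕ → ℝ := fun i => clampAngle (φ i) with hθ
  have hθ0 : ∀ i, 0 ≤ θ i := fun i => clampAngle_nonneg _
  have hθpi : ∀ i, θ i ≤ Real.pi := fun i => clampAngle_le_pi _
  have hθmono : ∀ i < N, θ i ≤ θ (i + 1) := fun i hi => clampAngle_mono (by
    simp only [hφ]; linarith [hΨ i (by omega), hΨ (i + 1) (by omega)])
  have hsin : ∀ i ≤ N, 0 ≤ Real.sin ((Ψ (i + 1) - Ψ i) / 2) := fun i hi =>
    Real.sin_nonneg_of_nonneg_of_le_pi (by linarith [hΨ i hi])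
      (by linarith [hΨle (i + 1) (by omega), hΨnn i (by omega)])
  -- The pairing of a point with the difference of two consecutive directions.
  have hpair : ∀ (a b : ℝ) (i : ℕ), a * (Real.cos (Ψ i) - Real.cos (Ψ (i + 1))) +
      b * (Real.sin (Ψ i) - Real.sin (Ψ (i + 1))) =
      2 * Real.sin ((Ψ (i + 1) - Ψ i) / 2) * (a * Real.cos (φ i) + b * Real.sin (φ i)) := by
    intro a b i
    rw [cos_sub_cos_eq, sin_sub_sin_eq]; ring
  set X : ℕ → ℝ := fun i => r * Real.cos (θ i) with hX
  set Y : ℕ → ℝ := fun i => r * Real.sin (θ i) with hY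
  have hterm : ∀ i ∈ Finset.range (N + 1),
      x i * (Real.cos (Ψ i) - Real.cos (Ψ (i + 1))) + y i * (Real.sin (Ψ i) - Real.sin (Ψ (i + 1)))
      ≤ X i * (Real.cos (Ψ i) - Real.cos (Ψ (i + 1))) +
        Y i * (Real.sin (Ψ i) - Real.sin (Ψ (i + 1))) := by
    intro i hi
    have hi : i ≤ N := Nat.lt_succ_iff.1 (Finset.mem_range.1 hi)
    rw [hpair, hpair]
    have hb1 := hΨnn i (by omega)
    have hb2 := hΨnn (i + 1) (by omega)
    have hb3 := hΨle i (by omega)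
    have hb4 := hΨle (i + 1) (by omega)
    have := halfDisc_support hr (hdisc i hi) (hpos i hi) (φ := φ i)
      (by simp only [hφ]; linarith) (by simp only [hφ]; linarith)
    exact mul_le_mul_of_nonneg_left this (by linarith [hsin i hi])
  have hsum := Finset.sum_le_sum hterm
  have hsumeq := fun h => (Finset.sum_eq_sum_iff_of_le hterm).1 h
  have hL := sum_inner_sub_eq x y (fun i => Real.cos (Ψ i)) (fun i => Real.sin (Ψ i)) N
  have hW := sum_inner_sub_eq X Y (fun i => Real.cos (Ψ i)) (fun i => Real.sin (Ψ i)) N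
  simp only [hΨ0, hΨN, Real.cos_zero, Real.sin_zero, Real.cos_two_pi, Real.sin_two_pi, mul_one,
    mul_zero, add_zero] at hL hW
  have hside : ∑ i ∈ Finset.range N, ((x (i + 1) - x i) * Real.cos (Ψ (i + 1)) +
      (y (i + 1) - y i) * Real.sin (Ψ (i + 1))) = ∑ i ∈ Finset.range N, ℓ i := by
    refine Finset.sum_congr rfl fun i hi => ?_
    have hi := Finset.mem_range.1 hi
    rw [hx i hi, hy i hi]
    linear_combination (ℓ i) * Real.sin_sq_add_cos_sq (Ψ (i + 1))
  rw [hside] at hL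
  have hchord : ∀ i ∈ Finset.range N, (X (i + 1) - X i) * Real.cos (Ψ (i + 1)) +
      (Y (i + 1) - Y i) * Real.sin (Ψ (i + 1)) ≤ 2 * r * Real.sin ((θ (i + 1) - θ i) / 2) := by
    intro i hi
    exact chord_inner_le hr (hθmono i (Finset.mem_range.1 hi))
      (by linarith [hθpi (i + 1), hθ0 i]) _
  have hcs := Finset.sum_le_sum hchord
  have hcseq := fun h => (Finset.sum_eq_sum_iff_of_le hchord).1 h
  rw [← Finset.mul_sum] at hcs hcseq
  have htel : ∑ i ∈ Finset.range N, (θ (i + 1) - θ i) = θ N - θ 0 := Finset.sum_range_sub _ _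
  obtain ⟨hJ, hJe⟩ := sum_sin_half_le hN (d := fun i => θ (i + 1) - θ i)
    (fun i hi => sub_nonneg.2 (hθmono i hi)) (by rw [htel]; linarith [hθpi N, hθ0 0])
  set T := ∑ i ∈ Finset.range N, Real.sin ((θ (i + 1) - θ i) / 2) with hT
  have hdiam : X 0 - X N ≤ 2 * r := by
    simp only [hX]; nlinarith [Real.cos_le_one (θ 0), Real.neg_one_le_cos (θ N)]
  have hrT : 2 * r * T ≤ 2 * r * (N * Real.sin (Real.pi / (2 * N))) := by gcongr
  refine ⟨by linarith, fun hr0 heq => ?_⟩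
  have hterm_eq := hsumeq (by linarith)
  have hchord_eq := hcseq (by linarith)
  have hstep := hJe (by
    have : 2 * r * T = 2 * r * (N * Real.sin (Real.pi / (2 * N))) := by linarith
    exact mul_left_cancel₀ (by positivity) this)
  have hdiam_eq : r * Real.cos (θ 0) - r * Real.cos (θ N) = 2 * r := by
    have : X 0 - X N = 2 * r := by linarith
    exact this
  have hstart : θ 0 = 0 := by
    refine Real.injOn_cos ⟨hθ0 0, hθpi 0⟩ ⟨le_rfl, hpi.le⟩ ?_
    rw [Real.cos_zero]
    nlinarith [Real.cos_le_one (θ 0), Real.neg_one_le_cos (θ N)]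
  have hθi : ∀ i ≤ N, θ i = i * Real.pi / N := by
    intro i
    induction i with
    | zero => intro _; rw [hstart]; simp
    | succ i ih =>
      intro hi
      have h1 := hstep i (by omega)
      have h2 := ih (by omega)
      push_cast
      rw [show θ (i + 1) = θ i + Real.pi / N by linarith, h2]; ring
  -- The directions of the sides are those of the sides of the regular polygon.
  have hdir : ∀ i < N, Real.cos (Ψ (i + 1)) = -Real.sin ((2 * i + 1) * Real.pi / (2 * N)) ∧
      Real.sin (Ψ (i + 1)) = Real.cos ((2 * i + 1) * Real.pi / (2 * N)) := by
    intro i hi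
    have h1 := direction_of_chord_inner_eq hr0 (α := θ i) (β := θ (i + 1)) (ψ := Ψ (i + 1))
      (by have := hstep i hi; have : 0 < Real.pi / N := by positivity
          linarith)
      (by linarith [hθpi (i + 1), hθ0 i]) (hchord_eq i (Finset.mem_range.2 hi))
    have h2 : (θ i + θ (i + 1)) / 2 = (2 * i + 1) * Real.pi / (2 * N) := by
      rw [hθi i hi.le, hθi (i + 1) hi]; push_cast; field_simp; ring
    rwa [h2] at h1
  intro i hi
  have hi1 := hterm_eq i (Finset.mem_range.2 (by omega))
  rcases Nat.eq_zero_or_pos i with rfl | hi0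
  · have hs : 0 ≤ Real.sin (Real.pi / (2 * N)) := sin_pi_div_two_mul_nonneg hN
    have hc := (hdir 0 hN).1
    simp only [Nat.cast_zero, mul_zero, zero_add, one_mul] at hc
    simp only [hX, hY, hstart, hΨ0, hy0, zero_add, hc, Real.cos_zero, Real.sin_zero] at hi1
    refine ⟨?_, by simp [hy0]⟩
    simp only [Nat.cast_zero, zero_mul, zero_div, Real.cos_zero, mul_one]
    have h0 : (x 0 - r) * (1 + Real.sin (Real.pi / (2 * N))) = 0 := by linear_combination hi1
    rcases mul_eq_zero.1 h0 with h | h <;> linarith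
  rcases hi.eq_or_lt with rfl | hiN
  · have hs : 0 ≤ Real.sin ((2 * ((i - 1 : ℕ) : ℝ) + 1) * Real.pi / (2 * i)) := by
      have h1 : ((i - 1 : ℕ) : ℝ) = i - 1 := by rw [Nat.cast_sub hi0, Nat.cast_one]
      have h2 : (1 : ℝ) ≤ i := by exact_mod_cast hi0
      rw [h1]
      apply Real.sin_nonneg_of_nonneg_of_le_pi
      · apply div_nonneg _ (by positivity)
        apply mul_nonneg _ hpi.le; linarith
      · rw [div_le_iff₀ (by positivity)]; nlinarith
    have hc := (hdir (i - 1) (by omega)).1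
    rw [show i - 1 + 1 = i by omega] at hc
    have hθN : θ i = Real.pi := by rw [hθi i le_rfl]; field_simp
    simp only [hX, hY, hθN, hΨN, hyN, hc, Real.cos_pi, Real.sin_pi, Real.cos_two_pi] at hi1
    rw [show (i : ℝ) * Real.pi / i = Real.pi by field_simp, Real.cos_pi, Real.sin_pi]
    refine ⟨?_, by rw [hyN, mul_zero]⟩
    have h0 : (x i + r) * (1 + Real.sin ((2 * ((i - 1 : ℕ) : ℝ) + 1) * Real.pi / (2 * i))) = 0 := by
      linear_combination -hi1
    rcases mul_eq_zero.1 h0 with h | h <;> linarith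
  · have hiR : (0 : ℝ) < i := by exact_mod_cast hi0
    have hiNR : (i : ℝ) < N := by exact_mod_cast hiN
    have hθφ : θ i = φ i := by
      apply clampAngle_of_mem
      · change 0 < θ i
        rw [hθi i hi]; positivity
      · change θ i < Real.pi
        rw [hθi i hi, div_lt_iff₀ hN0]; nlinarith
    have hne : Real.sin ((Ψ (i + 1) - Ψ i) / 2) ≠ 0 := by
      intro h0
      have h1 := sin_sub_sin_eq (Ψ i) (Ψ (i + 1))
      rw [h0, mul_zero, zero_mul, sub_eq_zero] at h1
      have h2 := (hdir (i - 1) (by omega)).2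
      rw [show i - 1 + 1 = i by omega, Nat.cast_sub hi0, Nat.cast_one] at h2
      rw [h2, (hdir i hiN).2] at h1
      have h3 : (1 : ℝ) ≤ i := by exact_mod_cast hi0
      have h4 : (i : ℝ) + 1 ≤ N := by exact_mod_cast hiN
      have h5 := Real.injOn_cos ⟨?_, ?_⟩ ⟨?_, ?_⟩ h1
      · rw [div_left_inj' (by positivity)] at h5
        nlinarith
      · apply div_nonneg _ (by positivity)
        apply mul_nonneg _ hpi.le; linarith
      · rw [div_le_iff₀ (by positivity)]; nlinarith
      · positivity
      · rw [div_le_iff₀ (by positivity)]; nlinarith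
    rw [hpair, hpair] at hi1
    have h1 := mul_left_cancel₀ (mul_ne_zero two_ne_zero hne) hi1
    simp only [hX, hY, hθφ] at h1
    have h2 := eq_of_mul_cos_add_mul_sin_eq (hdisc i hi) (φ := φ i) (by
      rw [h1]; linear_combination r * Real.sin_sq_add_cos_sq (φ i))
    rwa [← hθφ, hθi i hi] at h2

/-- The estimate for a convex polygon in a half disc with one side on the diameter. -/
lemma halfDisc_convex_chain_le {N : ℕ} (hN : 0 < N) {r : ℝ} (hr : 0 ≤ r) {x y : ℕ → ℝ}
    (hdisc : ∀ i ≤ N, x i ^ 2 + y i ^ 2 ≤ r ^ 2) (hpos : ∀ i, 0 < i → i < N → 0 < y i)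
    (hy0 : y 0 = 0) (hyN : y N = 0)
    (hturn : ∀ i, i + 1 < N →
      0 < (x (i + 1) - x i) * (y (i + 2) - y i) - (y (i + 1) - y i) * (x (i + 2) - x i))
    (hleft : ∀ i < N, 0 ≤ (x (i + 1) - x i) * (y 0 - y i) - (y (i + 1) - y i) * (x 0 - x i)) :
    x 0 - x N + ∑ i ∈ Finset.range N, √((x (i + 1) - x i) ^ 2 + (y (i + 1) - y i) ^ 2) ≤
        2 * (1 + N * Real.sin (Real.pi / (2 * N))) * r ∧
      (0 < r → x 0 - x N +
          ∑ i ∈ Finset.range N, √((x (i + 1) - x i) ^ 2 + (y (i + 1) - y i) ^ 2) =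
          2 * (1 + N * Real.sin (Real.pi / (2 * N))) * r →
        ∀ i ≤ N, x i = r * Real.cos (i * Real.pi / N) ∧ y i = r * Real.sin (i * Real.pi / N)) := by
  have hpi := Real.pi_pos
  choose ψ hψ0 hψ2 hψx hψy using
    fun i => exists_polar_angle (x (i + 1) - x i) (y (i + 1) - y i)
  obtain ⟨ℓ, hℓ⟩ : ∃ ℓ : ℕ → ℝ, ∀ i, √((x (i + 1) - x i) ^ 2 + (y (i + 1) - y i) ^ 2) = ℓ i :=
    ⟨_, fun _ => rfl⟩
  have hℓ0 : ∀ i, 0 ≤ ℓ i := fun i => hℓ i ▸ Real.sqrt_nonneg _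
  simp only [hℓ] at hψx hψy ⊢
  -- The angle could only drop at a vertex of minimal height, that is, not between `0` and `N`.
  have hmono : ∀ i, i + 1 < N → ψ i ≤ ψ (i + 1) := by
    intro i hi
    by_contra! hlt
    have hc := hturn i hi
    have h1 : x (i + 2) - x i = (x (i + 1) - x i) + (x (i + 1 + 1) - x (i + 1)) := by ring_nf
    have h2 : y (i + 2) - y i = (y (i + 1) - y i) + (y (i + 1 + 1) - y (i + 1)) := by ring_nf
    have hc' : 0 < (x (i + 1) - x i) * (y (i + 1 + 1) - y (i + 1)) -
        (y (i + 1) - y i) * (x (i + 1 + 1) - x (i + 1)) := by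
      rw [h1, h2] at hc; linarith
    have hc2 : 0 < ℓ i * ℓ (i + 1) * Real.sin (ψ (i + 1) - ψ i) := by
      rw [Real.sin_sub]
      calc _ < _ := hc'
        _ = _ := by rw [hψx i, hψy i, hψx (i + 1), hψy (i + 1)]; ring
    have hs : 0 < Real.sin (ψ (i + 1) - ψ i) :=
      pos_of_mul_pos_right hc2 (mul_nonneg (hℓ0 _) (hℓ0 _))
    have hgap : ψ (i + 1) - ψ i < -Real.pi := by
      by_contra! h
      exact absurd hs (not_lt.2 (Real.sin_nonpos_of_nonpos_of_neg_pi_le (by linarith) h))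
    have hdown : y (i + 1) - y i ≤ 0 := by
      rw [hψy i]
      refine mul_nonpos_of_nonneg_of_nonpos (hℓ0 i) ?_
      rw [← Real.sin_sub_two_pi]
      exact Real.sin_nonpos_of_nonpos_of_neg_pi_le (by linarith [hψ2 i])
        (by linarith [hψ0 (i + 1)])
    have hup : 0 ≤ y (i + 1 + 1) - y (i + 1) := by
      rw [hψy (i + 1)]
      exact mul_nonneg (hℓ0 _) (Real.sin_nonneg_of_nonneg_of_le_pi (hψ0 _)
        (by linarith [hψ2 i]))
    have hA := hleft i (by omega)
    have hB := hleft (i + 1) hi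
    have hP := hpos (i + 1) (by omega) hi
    rw [hy0] at hA hB
    -- Express the first vertex in the basis of the two sides at the vertex `i + 1`.
    set a := x (i + 1) - x i with ha
    set b := y (i + 1) - y i with hb
    set c := x (i + 1 + 1) - x (i + 1)
    set d := y (i + 1 + 1) - y (i + 1)
    have hA' : 0 ≤ a * (0 - y (i + 1)) - b * (x 0 - x (i + 1)) := by
      have : a * (0 - y (i + 1)) - b * (x 0 - x (i + 1)) = a * (0 - y i) - b * (x 0 - x i) := by
        simp only [ha, hb]; ring
      linarith
    have key : (a * d - b * c) * y (i + 1) =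
        b * (c * (0 - y (i + 1)) - d * (x 0 - x (i + 1))) -
          d * (a * (0 - y (i + 1)) - b * (x 0 - x (i + 1))) := by ring
    have k1 := mul_pos hc' hP
    have k2 := mul_nonneg (neg_nonneg.2 hdown) hB
    have k3 := mul_nonneg hup hA'
    linarith
  refine halfDisc_chain_le hN hr (ℓ := ℓ)
    (Ψ := fun i => if i = 0 then 0 else if i = N + 1 then 2 * Real.pi else ψ (i - 1))
    (by simp) (by simp) ?_ ?_ ?_ hdisc ?_ hy0 hyN
  · intro i hi
    rcases Nat.eq_zero_or_pos i with rfl | h0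
    · simp only [if_true, zero_add, one_ne_zero, if_false]
      split_ifs
      · positivity
      · exact hψ0 _
    · have h1 : i ≠ 0 := by omega
      have h2 : i ≠ N + 1 := by omega
      simp only [h1, h2, if_false, Nat.add_eq_zero_iff, one_ne_zero, and_false]
      split_ifs with h3
      · exact (hψ2 _).le
      · obtain ⟨j, rfl⟩ : ∃ j, i = j + 1 := ⟨i - 1, by omega⟩
        simpa using hmono j (by omega)
  · intro i hi
    simp only [Nat.add_eq_zero_iff, one_ne_zero, and_false, if_false,
      show ¬ (i + 1 = N + 1) by omega, Nat.add_sub_cancel]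
    exact hψx i
  · intro i hi
    simp only [Nat.add_eq_zero_iff, one_ne_zero, and_false, if_false,
      show ¬ (i + 1 = N + 1) by omega, Nat.add_sub_cancel]
    exact hψy i
  · intro i hi
    rcases Nat.eq_zero_or_pos i with rfl | h0
    · exact hy0.ge
    rcases hi.eq_or_lt with rfl | h1
    · exact hyN.ge
    · exact (hpos i h0 h1).le

/-! ### Supporting lines in the plane -/

/-- The signed area `a₀ b₁ - a₁ b₀` of the parallelogram spanned by `a` and `b`. -/
def planeCross (a b : Plane) : ℝ := a 0 * b 1 - a 1 * b 0

/-- A convex set in the plane has a supporting line at each of its points that lies on its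
frontier, also when the set has empty interior. -/
lemma exists_support_of_mem_frontier {K : Set Plane} (hK : Convex ℝ K) {m : Plane} (hmK : m ∈ K)
    (hm : m ∈ frontier K) :
    ∃ f : Plane →L[ℝ] ℝ, f ≠ 0 ∧ ∀ q ∈ K, f q ≤ f m := by
  rcases (interior K).eq_empty_or_nonempty with h | h
  · have hspan : affineSpan ℝ K ≠ ⊤ := fun h' => by
      rw [← hK.interior_nonempty_iff_affineSpan_eq_top, h] at h'
      exact Set.not_nonempty_empty h'
    have hdir : (affineSpan ℝ K).direction < ⊤ := by
      refine lt_top_iff_ne_top.2 fun h' => hspan ?_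
      exact (AffineSubspace.direction_eq_top_iff_of_nonempty
        ⟨m, subset_affineSpan ℝ K hmK⟩).1 h'
    obtain ⟨f, hf, hle⟩ := Submodule.exists_le_ker_of_lt_top _ hdir
    refine ⟨LinearMap.toContinuousLinearMap f, by simpa using hf, fun q hq => ?_⟩
    have : f (q - m) = 0 := hle (AffineSubspace.vsub_mem_direction
      (subset_affineSpan ℝ K hq) (subset_affineSpan ℝ K hmK))
    rw [map_sub, sub_eq_zero] at this
    exact this.le
  · obtain ⟨f, hf⟩ := geometric_hahn_banach_open_point hK.interior isOpen_interior hm.2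
    refine ⟨f, ?_, fun q hq => ?_⟩
    · rintro rfl
      obtain ⟨q, hq⟩ := h
      exact lt_irrefl _ (hf q hq)
    · have hq' : q ∈ closure (interior K) := by
        rw [hK.closure_interior_eq_closure_of_nonempty_interior h]
        exact subset_closure hq
      exact closure_minimal (fun a ha => (hf a ha).le)
        (isClosed_le f.continuous continuous_const) hq'

/-- Conversely, a point where a nonzero functional is maximal lies on the frontier. -/
lemma mem_frontier_of_support {K : Set Plane} {m : Plane} (hmK : m ∈ K) {f : Plane →L[ℝ] ℝ}
    (hf : f ≠ 0) (h : ∀ q ∈ K, f q ≤ f m) : m ∈ frontier K := by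
  refine ⟨subset_closure hmK, fun hint => hf ?_⟩
  have hmax : IsLocalMax f m := by
    filter_upwards [mem_interior_iff_mem_nhds.1 hint] with q hq using h q hq
  have := hmax.fderiv_eq_zero
  rwa [f.fderiv] at this

lemma plane_clm_apply (f : Plane →L[ℝ] ℝ) (q : Plane) :
    f q = q 0 * f (EuclideanSpace.single 0 1) + q 1 * f (EuclideanSpace.single 1 1) := by
  have : q = q 0 • EuclideanSpace.single 0 (1 : ℝ) + q 1 • EuclideanSpace.single 1 (1 : ℝ) := by
    ext i; fin_cases i <;> simp
  conv_lhs => rw [this]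
  simp

lemma sq_add_sq_pos_of_ne_zero {d : Plane} (hd : d ≠ 0) : 0 < d 0 ^ 2 + d 1 ^ 2 := by
  rw [← Fin.sum_univ_two fun i => d i ^ 2, ← EuclideanSpace.real_norm_sq_eq]
  exact pow_pos (norm_pos_iff.2 hd) 2

/-- A functional that vanishes on `d ≠ 0` is a multiple of `planeCross d`. -/
lemma exists_eq_mul_planeCross {f : Plane →L[ℝ] ℝ} (hf : f ≠ 0) {d : Plane} (hd : d ≠ 0)
    (h : f d = 0) : ∃ t : ℝ, t ≠ 0 ∧ ∀ q, f q = t * planeCross d q := by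
  set a := f (EuclideanSpace.single 0 1) with ha
  set b := f (EuclideanSpace.single 1 1) with hb
  have hfq : ∀ q, f q = q 0 * a + q 1 * b := plane_clm_apply f
  have hd2 := sq_add_sq_pos_of_ne_zero hd
  rw [hfq] at h
  have hall : ∀ q, f q = (d 0 * b - d 1 * a) / (d 0 ^ 2 + d 1 ^ 2) * planeCross d q := by
    intro q
    rw [hfq]
    unfold planeCross
    field_simp
    linear_combination (d 0 * q 0 + d 1 * q 1) * h
  refine ⟨_, ?_, hall⟩
  intro h0
  apply hf
  ext q
  rw [hall, h0, zero_mul]; rfl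

/-- `planeCross d` as a continuous functional. -/
noncomputable def planeCrossCLM (d : Plane) : Plane →L[ℝ] ℝ :=
  LinearMap.toContinuousLinearMap
    { toFun := planeCross d
      map_add' := fun a b => by simp [planeCross]; ring
      map_smul' := fun t a => by simp [planeCross]; ring }

@[simp] lemma planeCrossCLM_apply (d q : Plane) : planeCrossCLM d q = planeCross d q := rfl

lemma planeCross_self (d : Plane) : planeCross d d = 0 := by unfold planeCross; ring

lemma planeCross_sub_right (d a b : Plane) :
    planeCross d (a - b) = planeCross d a - planeCross d b := by
  simp [planeCross]; ring

lemma planeCrossCLM_ne_zero {d : Plane} (hd : d ≠ 0) : planeCrossCLM d ≠ 0 := by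
  intro h
  apply hd
  have h0 : planeCross d (EuclideanSpace.single 1 1) = 0 := by
    rw [← planeCrossCLM_apply, h]; rfl
  have h1 : planeCross d (EuclideanSpace.single 0 1) = 0 := by
    rw [← planeCrossCLM_apply, h]; rfl
  ext i
  fin_cases i
  · simpa [planeCross] using h0
  · simpa [planeCross] using h1

lemma eq_smul_of_planeCross_eq_zero {d e : Plane} (hd : d ≠ 0) (h : planeCross d e = 0) :
    ∃ t : ℝ, e = t • d := by
  have hd2 := sq_add_sq_pos_of_ne_zero hd
  unfold planeCross at h
  refine ⟨(d 0 * e 0 + d 1 * e 1) / (d 0 ^ 2 + d 1 ^ 2), ?_⟩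
  ext i
  fin_cases i
  · simp; field_simp; linear_combination (-d 1) * h
  · simp; field_simp; linear_combination (d 0) * h

/-- Three distinct extreme points are not collinear. -/
lemma planeCross_ne_zero_of_extreme {K : Set Plane} {a b c : Plane} (ha : a ∈ K.extremePoints ℝ)
    (hb : b ∈ K.extremePoints ℝ) (hc : c ∈ K.extremePoints ℝ) (hab : a ≠ b) (hac : a ≠ c)
    (hbc : b ≠ c) : planeCross (b - a) (c - a) ≠ 0 := by
  intro h
  obtain ⟨t, ht⟩ := eq_smul_of_planeCross_eq_zero (sub_ne_zero.2 hab.symm) h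
  have hcol : Collinear ℝ {a, b, c} := by
    rw [collinear_iff_of_mem (p₀ := a) (by simp)]
    refine ⟨b - a, ?_⟩
    simp only [Set.mem_insert_iff, Set.mem_singleton_iff, forall_eq_or_imp, forall_eq]
    refine ⟨⟨0, by simp⟩, ⟨1, by simp⟩, ⟨t, ?_⟩⟩
    rw [← ht]; simp
  have key : ∀ {p q r : Plane}, p ∈ K.extremePoints ℝ → q ∈ K.extremePoints ℝ →
      r ∈ K.extremePoints ℝ → p ≠ q → q ≠ r → ¬ Wbtw ℝ p q r := by
    intro p q r hp hq hr hpq hqr hw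
    have hs := mem_extremePoints_iff_forall_segment.1 hq
    rcases hs.2 p hp.1 r hr.1 (by rwa [← affineSegment_eq_segment]) with h1 | h1
    · exact hpq h1
    · exact hqr h1.symm
  rcases hcol.wbtw_or_wbtw_or_wbtw with h1 | h1 | h1
  · exact key ha hb hc hab hbc h1
  · exact key hb hc ha hbc hac.symm h1
  · exact key hc ha hb hac.symm hab h1

/-! ### Convex polygons and orientation -/

section Polygon

variable {N : ℕ} {v : Fin (N + 1) → Plane}

lemma polygonalChain_eq (v : Fin (N + 1) → Plane) :
    polygonalChain v = ⋃ i, segment ℝ (v i) (v (i + 1)) := by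
  simp only [polygonalChain, finRotate_apply]

lemma perimeter_eq (v : Fin (N + 1) → Plane) : perimeter v = ∑ i, dist (v i) (v (i + 1)) := by
  simp only [perimeter, finRotate_apply]

lemma fin_ne_add_one (hN : 0 < N) (i : Fin (N + 1)) : i ≠ i + 1 := by
  intro h
  have : (1 : Fin (N + 1)) = 0 := by simpa using h.symm
  have := congrArg Fin.val this
  simp at this
  omega

/-- Each side of a convex polygon has all other vertices strictly on one side. -/
lemma IsConvexNgon.exists_side (hN : 0 < N) (hv : IsConvexNgon v) (i : Fin (N + 1)) :
    ∃ t : ℝ, ∀ j, j ≠ i → j ≠ i + 1 → 0 < t * planeCross (v (i + 1) - v i) (v j - v i) := by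
  set K := convexHull ℝ (Set.range v)
  have hvK : ∀ j, v j ∈ K := fun j => subset_convexHull ℝ _ ⟨j, rfl⟩
  have hne : v i ≠ v (i + 1) := fun h => fin_ne_add_one hN i (hv.injective h)
  set m := midpoint ℝ (v i) (v (i + 1)) with hm
  have hmseg : m ∈ segment ℝ (v i) (v (i + 1)) := midpoint_mem_segment _ _
  have hmfr : m ∈ frontier K := by
    rw [← hv.chain_eq, polygonalChain_eq]
    exact Set.mem_iUnion.2 ⟨i, hmseg⟩
  have hmK : m ∈ K := (convex_convexHull ℝ _).segment_subset (hvK _) (hvK _) hmseg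
  obtain ⟨f, hf, hmax⟩ := exists_support_of_mem_frontier (convex_convexHull ℝ _) hmK hmfr
  have h2 : f m + f m = f (v i) + f (v (i + 1)) := by
    rw [← map_add, ← map_add, hm, midpoint_add_self]
  have hi := hmax _ (hvK i)
  have hi1 := hmax _ (hvK (i + 1))
  obtain ⟨t, ht, hft⟩ := exists_eq_mul_planeCross hf (sub_ne_zero.2 hne.symm)
    (by rw [map_sub]; linarith)
  refine ⟨-t, fun j hj hj1 => lt_of_le_of_ne ?_ (Ne.symm ?_)⟩
  · have h3 := hft (v j - v i)
    rw [map_sub] at h3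
    have h4 := hmax _ (hvK j)
    linarith
  · exact mul_ne_zero (neg_ne_zero.2 ht) (planeCross_ne_zero_of_extreme (hv.extreme _)
      (hv.extreme _) (hv.extreme _) hne (fun h => hj (hv.injective h).symm)
      (fun h => hj1 (hv.injective h).symm))

lemma fin_add_two_ne (hN : 1 < N) (i : Fin (N + 1)) : i + 1 + 1 ≠ i := by
  intro h
  rw [add_assoc] at h
  have h : (1 + 1 : Fin (N + 1)) = 0 := by simpa using h
  have := congrArg Fin.val h
  rw [Fin.val_add] at this
  simp only [Fin.val_one', Fin.val_zero] at this
  rw [Nat.mod_eq_of_lt (by omega : 1 < N + 1), Nat.mod_eq_of_lt (by omega)] at this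
  omega

/-- A convex polygon is traversed in one and the same orientation along all its sides. -/
lemma IsConvexNgon.exists_orientation (hN : 0 < N) (hv : IsConvexNgon v) :
    ∃ s : ℝ, (s = 1 ∨ s = -1) ∧ ∀ i j, j ≠ i → j ≠ i + 1 →
      0 < s * planeCross (v (i + 1) - v i) (v j - v i) := by
  rcases Nat.lt_or_ge 1 N with hN1 | hN1
  swap
  · obtain rfl : N = 1 := by omega
    refine ⟨1, Or.inl rfl, fun i j h1 h2 => ?_⟩
    fin_cases i <;> fin_cases j <;> simp at h1 h2
  have hsgn : ∀ i, ∃ s : ℝ, (s = 1 ∨ s = -1) ∧ ∀ j, j ≠ i → j ≠ i + 1 →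
      0 < s * planeCross (v (i + 1) - v i) (v j - v i) := by
    intro i
    obtain ⟨t, ht⟩ := hv.exists_side hN i
    rcases lt_trichotomy t 0 with h | h | h
    · refine ⟨-1, Or.inr rfl, fun j h1 h2 => ?_⟩
      have := ht j h1 h2
      nlinarith
    · have := ht (i + 1 + 1) (fin_add_two_ne hN1 i) (fin_ne_add_one hN _).symm
      simp [h] at this
    · refine ⟨1, Or.inl rfl, fun j h1 h2 => ?_⟩
      have := ht j h1 h2
      nlinarith
  choose s hs hpos using hsgn
  have hstep : ∀ i, s (i + 1) = s i := by
    intro i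
    have h1 := hpos i (i + 1 + 1) (fin_add_two_ne hN1 i) (fin_ne_add_one hN _).symm
    have h2 := hpos (i + 1) i (fin_ne_add_one hN i) (fin_add_two_ne hN1 i).symm
    have h3 : planeCross (v (i + 1 + 1) - v (i + 1)) (v i - v (i + 1)) =
        planeCross (v (i + 1) - v i) (v (i + 1 + 1) - v i) := by
      simp [planeCross]; ring
    rw [h3] at h2
    rcases hs i with h | h <;> rcases hs (i + 1) with h' | h' <;> rw [h] at h1 ⊢ <;>
      rw [h'] at h2 ⊢ <;> linarith
  have hall : ∀ i, s i = s 0 := by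
    intro i
    induction i using Fin.induction with
    | zero => rfl
    | succ i ih => rw [← ih, ← hstep i.castSucc, Fin.coeSucc_eq_succ]
  exact ⟨s 0, hs 0, fun i j h1 h2 => hall i ▸ hpos i j h1 h2⟩

/-- Strict convexity at all sides makes a closed chain the boundary of its convex hull. -/
lemma polygonalChain_eq_frontier (hN : 0 < N) (hinj : Function.Injective v)
    (hpos : ∀ i j, j ≠ i → j ≠ i + 1 → 0 < planeCross (v (i + 1) - v i) (v j - v i)) :
    polygonalChain v = frontier (convexHull ℝ (Set.range v)) := by
  set K := convexHull ℝ (Set.range v) with hKdef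
  have hvK : ∀ j, v j ∈ K := fun j => subset_convexHull ℝ _ ⟨j, rfl⟩
  have hK : Convex ℝ K := convex_convexHull ℝ _
  have hclosed : IsClosed K := (Set.finite_range v).isClosed_convexHull ℝ
  have hweak : ∀ i j, planeCross (v (i + 1) - v i) (v i) ≤ planeCross (v (i + 1) - v i) (v j) := by
    intro i j
    rcases eq_or_ne j i with rfl | h1
    · exact le_rfl
    rcases eq_or_ne j (i + 1) with rfl | h2
    · exact (sub_eq_zero.1 (by rw [← planeCross_sub_right, planeCross_self])).ge
    · have := hpos i j h1 h2
      rw [planeCross_sub_right] at this; linarith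
  rw [polygonalChain_eq]
  apply Set.Subset.antisymm
  · refine Set.iUnion_subset fun i q hq => ?_
    have hne : v (i + 1) - v i ≠ 0 :=
      sub_ne_zero.2 fun h => fin_ne_add_one hN i (hinj h).symm
    have hqK : q ∈ K := hK.segment_subset (hvK _) (hvK _) hq
    refine mem_frontier_of_support hqK (f := -planeCrossCLM (v (i + 1) - v i))
      (neg_ne_zero.2 (planeCrossCLM_ne_zero hne)) fun p hp => ?_
    have hq0 : planeCross (v (i + 1) - v i) q = planeCross (v (i + 1) - v i) (v i) := by
      obtain ⟨a, b, ha, hb, hab, rfl⟩ := hq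
      rw [← planeCrossCLM_apply, map_add, map_smul, map_smul]
      simp only [planeCrossCLM_apply, smul_eq_mul]
      rw [show planeCross (v (i + 1) - v i) (v (i + 1)) = planeCross (v (i + 1) - v i) (v i) from
        sub_eq_zero.1 (by rw [← planeCross_sub_right, planeCross_self]), ← add_mul, hab, one_mul]
    have hsub : K ⊆ {p | planeCross (v (i + 1) - v i) (v i) ≤
        planeCrossCLM (v (i + 1) - v i) p} := by
      refine convexHull_min ?_ (convex_halfSpace_ge
        (planeCrossCLM (v (i + 1) - v i)).isBoundedLinearMap.toIsLinearMap _)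
      rintro _ ⟨j, rfl⟩
      exact hweak i j
    have := hsub hp
    simp only [Set.mem_ofPred_eq, planeCrossCLM_apply] at this
    change -planeCross (v (i + 1) - v i) p ≤ -planeCross (v (i + 1) - v i) q
    rw [hq0]; linarith
  · intro q hq
    have hqK : q ∈ K := hclosed.frontier_subset hq
    obtain ⟨f, hf, hmax⟩ := exists_support_of_mem_frontier hK hqK hq
    obtain ⟨w, hw0, hw1, hwq⟩ : ∃ w : Fin (N + 1) → ℝ, (∀ i, 0 ≤ w i) ∧ ∑ i, w i = 1 ∧
        ∑ i, w i • v i = q := by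
      classical
      rw [hKdef, show Set.range v = ((Finset.univ.image v : Finset Plane) : Set Plane) by simp,
        Finset.mem_convexHull'] at hqK
      obtain ⟨w, h0, h1, h2⟩ := hqK
      rw [Finset.sum_image hinj.injOn] at h1 h2
      exact ⟨fun i => w (v i), fun i => h0 _ (by simp), h1, h2⟩
    -- Only vertices at which `f` is maximal contribute to `q`.
    have hface : ∀ i, w i ≠ 0 → f (v i) = f q := by
      have hsum : ∑ i, w i * (f q - f (v i)) = 0 := by
        simp only [mul_sub, Finset.sum_sub_distrib, ← Finset.sum_mul, hw1, one_mul]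
        rw [sub_eq_zero, ← hwq, map_sum]
        simp
      have hz := (Finset.sum_eq_zero_iff_of_nonneg (fun i _ => mul_nonneg (hw0 i)
        (sub_nonneg.2 (hmax _ (hvK i))))).1 hsum
      intro i hi
      have := (mul_eq_zero.1 (hz i (Finset.mem_univ i))).resolve_left hi
      linarith
    obtain ⟨j, hj⟩ : ∃ j, w j ≠ 0 := by
      by_contra! h
      simp [h] at hw1
    -- A second vertex of the face is adjacent to the first one.
    have hadj : ∀ k, w k ≠ 0 → k ≠ j → k = j + 1 ∨ j = k + 1 := by
      intro k hk hkj
      by_contra! hno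
      obtain ⟨t, ht, hft⟩ := exists_eq_mul_planeCross hf
        (sub_ne_zero.2 (hinj.ne hkj)) (by rw [map_sub, hface k hk, hface j hj, sub_self])
      obtain ⟨l, hl⟩ : ∃ l, l + 1 = j := ⟨j - 1, sub_add_cancel _ _⟩
      have h1 := hpos j k hkj hno.1
      have h2 := hpos l k (fun h => hno.2 (by rw [h, hl])) (hl ▸ hkj)
      rw [hl] at h2
      have h3 := hmax _ (hvK (j + 1))
      have h4 := hmax _ (hvK l)
      rw [← hface j hj] at h3 h4
      have h5 := hft (v (j + 1) - v j)
      have h6 := hft (v l - v j)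
      rw [map_sub] at h5 h6
      have e1 : planeCross (v k - v j) (v (j + 1) - v j) =
          -planeCross (v (j + 1) - v j) (v k - v j) := by simp [planeCross]; ring
      have e2 : planeCross (v k - v j) (v l - v j) = planeCross (v j - v l) (v k - v l) := by
        simp [planeCross]; ring
      rw [e1] at h5
      rw [e2] at h6
      rcases lt_or_gt_of_ne ht with h | h <;> nlinarith
    obtain ⟨e, he⟩ : ∃ e, ∀ k, w k ≠ 0 → k = e ∨ k = e + 1 := by
      by_cases hex : ∃ k, w k ≠ 0 ∧ k ≠ j
      swap
      · exact ⟨j, fun k hk => Or.inl (by by_contra h; exact hex ⟨k, hk, h⟩)⟩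
      obtain ⟨k, hk, hkj⟩ := hex
      obtain ⟨e, he0, he1⟩ : ∃ e, w e ≠ 0 ∧ w (e + 1) ≠ 0 := by
        rcases hadj k hk hkj with rfl | rfl
        · exact ⟨j, hj, hk⟩
        · exact ⟨k, hk, hj⟩
      obtain ⟨t, ht, hft⟩ := exists_eq_mul_planeCross hf
        (sub_ne_zero.2 (hinj.ne (fin_ne_add_one hN e).symm))
        (by rw [map_sub, hface _ he0, hface _ he1, sub_self])
      refine ⟨e, fun m hm => ?_⟩
      by_contra! hno
      have h1 := hpos e m hno.1 hno.2
      have h2 := hft (v m - v e)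
      rw [map_sub, hface m hm, hface e he0, sub_self] at h2
      exact (mul_ne_zero ht h1.ne') h2.symm
    refine Set.mem_iUnion.2 ⟨e, ?_⟩
    have hsub : ∀ {M : Type} [AddCommMonoid M] (g : Fin (N + 1) → M), (∀ k, w k = 0 → g k = 0) →
        ∑ k, g k = g e + g (e + 1) := by
      intro M _ g hg
      rw [← Finset.sum_pair (fin_ne_add_one hN e)]
      refine (Finset.sum_subset (Finset.subset_univ _) fun k _ hk => hg k ?_).symm
      by_contra h
      exact hk (by simpa using he k h)
    refine ⟨w e, w (e + 1), hw0 _, hw0 _, ?_, ?_⟩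
    · rw [← hw1, hsub w fun _ h => h]
    · rw [← hwq, hsub _ fun k h => by rw [h, zero_smul]]

/-- Points of a circle are extreme points of their convex hull. -/
lemma mem_extremePoints_of_norm_eq {r : ℝ} (h : ∀ i, ‖v i‖ = r) (i : Fin (N + 1)) :
    v i ∈ (convexHull ℝ (Set.range v)).extremePoints ℝ := by
  have hsub : convexHull ℝ (Set.range v) ⊆ Metric.closedBall 0 r := by
    refine convexHull_min ?_ (convex_closedBall _ _)
    rintro _ ⟨j, rfl⟩
    simp [h j]
  refine mem_extremePoints_iff_left.2 ⟨subset_convexHull ℝ _ ⟨i, rfl⟩, fun a ha b hb hab => ?_⟩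
  by_contra hne
  have hab' : a ≠ b := by
    rintro rfl
    rw [openSegment_same] at hab
    exact hne hab.symm
  have hr : r ≠ 0 := by
    rintro rfl
    have h1 := hsub ha
    have h2 := hsub hb
    simp only [Metric.closedBall_zero, Set.mem_singleton_iff] at h1 h2
    exact hab' (h1.trans h2.symm)
  have := strictConvex_closedBall ℝ (0 : Plane) r (hsub ha) (hsub hb) hab'
  have h4 : v i ∈ interior (Metric.closedBall (0 : Plane) r) := by
    obtain ⟨s, t, hs, ht, hst, hv⟩ := hab
    rw [← hv]
    exact this hs ht hst
  rw [interior_closedBall _ hr, mem_ball_zero_iff, h i] at h4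
  exact lt_irrefl _ h4

end Polygon

lemma dist_plane (p q : Plane) : dist p q = √((p 0 - q 0) ^ 2 + (p 1 - q 1) ^ 2) := by
  rw [EuclideanSpace.dist_eq, Fin.sum_univ_two, Real.dist_eq, Real.dist_eq, sq_abs, sq_abs]

/-! ### The polygon `U_n(r)` -/

section HalfRegular

variable {N : ℕ}

lemma halfRegularVertices_zero (r : ℝ) (k : Fin (N + 1)) :
    halfRegularVertices (N + 1) r k 0 = r * Real.cos ((k : ℕ) * Real.pi / N) := by
  simp [halfRegularVertices]

lemma halfRegularVertices_one (r : ℝ) (k : Fin (N + 1)) :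
    halfRegularVertices (N + 1) r k 1 = r * Real.sin ((k : ℕ) * Real.pi / N) := by
  simp [halfRegularVertices]

lemma norm_halfRegularVertices {r : ℝ} (hr : 0 < r) (k : Fin (N + 1)) :
    ‖halfRegularVertices (N + 1) r k‖ = r := by
  rw [EuclideanSpace.norm_eq, Fin.sum_univ_two, halfRegularVertices_zero, halfRegularVertices_one,
    Real.norm_eq_abs, Real.norm_eq_abs, sq_abs, sq_abs]
  rw [show ∀ t : ℝ, (r * Real.cos t) ^ 2 + (r * Real.sin t) ^ 2 = r ^ 2 from fun t => by
    linear_combination r ^ 2 * Real.sin_sq_add_cos_sq t]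
  exact Real.sqrt_sq hr.le

lemma halfRegular_angle_mem_Icc (hN : 0 < N) (k : Fin (N + 1)) :
    (k : ℕ) * Real.pi / N ∈ Set.Icc 0 Real.pi := by
  have hN0 : (0 : ℝ) < N := by exact_mod_cast hN
  have hk : ((k : ℕ) : ℝ) ≤ N := by exact_mod_cast Nat.lt_succ_iff.1 k.2
  refine ⟨by positivity, ?_⟩
  rw [div_le_iff₀ hN0]
  nlinarith [Real.pi_pos]

lemma halfRegular_angle_lt (hN : 0 < N) {i j : ℕ} (h : i < j) :
    (i : ℝ) * Real.pi / N < (j : ℝ) * Real.pi / N := by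
  have hN0 : (0 : ℝ) < N := by exact_mod_cast hN
  have h' : (i : ℝ) < j := by exact_mod_cast h
  have := Real.pi_pos
  gcongr

lemma halfRegularVertices_injective (hN : 0 < N) {r : ℝ} (hr : 0 < r) :
    Function.Injective (halfRegularVertices (N + 1) r) := by
  intro i j hij
  have h0 := congrArg (fun p : Plane => p 0) hij
  simp only [halfRegularVertices_zero] at h0
  have h1 := Real.injOn_cos (halfRegular_angle_mem_Icc hN i) (halfRegular_angle_mem_Icc hN j)
    (mul_left_cancel₀ hr.ne' h0)
  rcases lt_trichotomy (i : ℕ) (j : ℕ) with h | h | h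
  · exact absurd h1 (halfRegular_angle_lt hN h).ne
  · exact Fin.ext h
  · exact absurd h1 (halfRegular_angle_lt hN h).ne'

/-- The doubled area of a triangle inscribed in the unit circle. -/
lemma circle_cross_eq (a b c : ℝ) :
    (Real.cos b - Real.cos a) * (Real.sin c - Real.sin a) -
        (Real.sin b - Real.sin a) * (Real.cos c - Real.cos a) =
      4 * Real.sin ((b - a) / 2) * Real.sin ((c - a) / 2) * Real.sin ((c - b) / 2) := by
  have h1 := cos_sub_cos_eq a b
  have h2 := sin_sub_sin_eq a b
  have h3 := cos_sub_cos_eq a c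
  have h4 := sin_sub_sin_eq a c
  rw [Real.cos_sub_pi_div_two] at h1 h3
  rw [Real.sin_sub_pi_div_two] at h2 h4
  have h5 : Real.sin ((c - b) / 2) = Real.sin ((a + c) / 2) * Real.cos ((a + b) / 2) -
      Real.cos ((a + c) / 2) * Real.sin ((a + b) / 2) := by
    rw [← Real.sin_sub]; ring_nf
  rw [h5, ← neg_sub (Real.cos a) (Real.cos b), ← neg_sub (Real.cos a) (Real.cos c),
    ← neg_sub (Real.sin a) (Real.sin b), ← neg_sub (Real.sin a) (Real.sin c), h1, h2, h3, h4]
  ring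

lemma planeCross_halfRegularVertices_pos (hN : 0 < N) {r : ℝ} (hr : 0 < r) (i j : Fin (N + 1))
    (hji : j ≠ i) (hji1 : j ≠ i + 1) :
    0 < planeCross (halfRegularVertices (N + 1) r (i + 1) - halfRegularVertices (N + 1) r i)
      (halfRegularVertices (N + 1) r j - halfRegularVertices (N + 1) r i) := by
  have hpi := Real.pi_pos
  have hN0 : (0 : ℝ) < N := by exact_mod_cast hN
  have key : planeCross (halfRegularVertices (N + 1) r (i + 1) - halfRegularVertices (N + 1) r i)
      (halfRegularVertices (N + 1) r j - halfRegularVertices (N + 1) r i) = r ^ 2 * (4 *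
      Real.sin ((((i + 1 : Fin (N + 1)) : ℕ) * Real.pi / N - (i : ℕ) * Real.pi / N) / 2) *
      Real.sin (((j : ℕ) * Real.pi / N - (i : ℕ) * Real.pi / N) / 2) *
      Real.sin (((j : ℕ) * Real.pi / N - ((i + 1 : Fin (N + 1)) : ℕ) * Real.pi / N) / 2)) := by
    rw [← circle_cross_eq]
    simp only [planeCross, PiLp.sub_apply, halfRegularVertices_zero, halfRegularVertices_one]
    ring
  rw [key]
  have hval : (j : ℕ) ≠ i := fun h => hji (Fin.ext h)
  have hval1 : (j : ℕ) ≠ (i + 1 : Fin (N + 1)) := fun h => hji1 (Fin.ext h)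
  have hi := halfRegular_angle_mem_Icc hN i
  have hj := halfRegular_angle_mem_Icc hN j
  have hi1 := halfRegular_angle_mem_Icc hN (i + 1)
  have hjN : (j : ℕ) ≤ N := Nat.lt_succ_iff.1 j.2
  have hsin : ∀ {a b : ℕ}, a < b → (b : ℝ) * Real.pi / N - a * Real.pi / N ≤ Real.pi →
      0 < Real.sin ((b * Real.pi / N - a * Real.pi / N) / 2) := fun h h' =>
    Real.sin_pos_of_pos_of_lt_pi (by linarith [halfRegular_angle_lt hN h]) (by linarith)
  have hsin' : ∀ {a b : ℕ}, b < a → (a : ℝ) * Real.pi / N - b * Real.pi / N ≤ Real.pi →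
      Real.sin ((b * Real.pi / N - a * Real.pi / N) / 2) < 0 := fun h h' => by
    rw [← neg_sub, neg_div, Real.sin_neg]
    linarith [hsin h h']
  obtain ⟨hi, hi'⟩ := hi
  obtain ⟨hj, hj'⟩ := hj
  obtain ⟨hi1, hi1'⟩ := hi1
  refine mul_pos (by positivity) ?_
  rcases eq_or_ne i (Fin.last N) with rfl | hlast
  · rw [Fin.last_add_one] at *
    simp only [Fin.val_last, Fin.val_zero] at *
    have s1 := hsin' (a := N) (b := 0) hN (by linarith)
    have s2 := hsin' (a := N) (b := j) (by omega) (by linarith)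
    have s3 := hsin (a := 0) (b := j) (by omega) (by linarith)
    exact mul_pos (mul_pos_of_neg_of_neg (by linarith) s2) s3
  · have hlt : i < Fin.last N := Fin.lt_last_iff_ne_last.2 hlast
    rw [Fin.val_add_one_of_lt hlt] at *
    have s1 := hsin (a := i) (b := i + 1) (by omega) (by linarith)
    rcases lt_or_gt_of_ne hval with h | h
    · have s2 := hsin' (a := i) (b := j) h (by linarith)
      have s3 := hsin' (a := i + 1) (b := j) (by omega) (by linarith)
      rw [mul_assoc]
      exact mul_pos (by linarith) (mul_pos_of_neg_of_neg s2 s3)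
    · have s2 := hsin (a := i) (b := j) h (by linarith)
      have s3 := hsin (a := i + 1) (b := j) (by omega) (by linarith)
      exact mul_pos (mul_pos (by linarith) s2) s3

lemma isConvexNgon_halfRegularVertices (hN : 0 < N) {r : ℝ} (hr : 0 < r) :
    IsConvexNgon (halfRegularVertices (N + 1) r) where
  injective := halfRegularVertices_injective hN hr
  extreme := mem_extremePoints_of_norm_eq (norm_halfRegularVertices hr)
  chain_eq := polygonalChain_eq_frontier hN (halfRegularVertices_injective hN hr)
    (planeCross_halfRegularVertices_pos hN hr)

lemma perimeter_halfRegularVertices (hN : 0 < N) {r : ℝ} (hr : 0 < r) :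
    perimeter (halfRegularVertices (N + 1) r) =
      2 * (1 + N * Real.sin (Real.pi / (2 * N))) * r := by
  have hN0 : (0 : ℝ) < N := by exact_mod_cast hN
  have hpi := Real.pi_pos
  have hside : ∀ i : Fin N, dist (halfRegularVertices (N + 1) r i.castSucc)
      (halfRegularVertices (N + 1) r (i.castSucc + 1)) =
      2 * r * Real.sin (Real.pi / (2 * N)) := by
    intro i
    have hs : 0 ≤ Real.sin (Real.pi / (2 * N)) := sin_pi_div_two_mul_nonneg hN
    rw [Fin.coeSucc_eq_succ, dist_plane]
    simp only [halfRegularVertices_zero, halfRegularVertices_one, Fin.val_castSucc, Fin.val_succ]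
    rw [← mul_sub, ← mul_sub, cos_sub_cos_eq, sin_sub_sin_eq]
    have he : (((i : ℕ) + 1 : ℕ) * Real.pi / N - (i : ℕ) * Real.pi / N) / 2 =
        Real.pi / (2 * N) := by push_cast; field_simp; ring
    rw [he, ← Real.sqrt_sq (show 0 ≤ 2 * r * Real.sin (Real.pi / (2 * N)) by positivity)]
    congr 1
    set m := ((i : ℕ) * Real.pi / N + ((i : ℕ) + 1 : ℕ) * Real.pi / N) / 2 - Real.pi / 2
    linear_combination (4 * r ^ 2 * Real.sin (Real.pi / (2 * N)) ^ 2) * Real.sin_sq_add_cos_sq m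
  have hdiam : dist (halfRegularVertices (N + 1) r (Fin.last N))
      (halfRegularVertices (N + 1) r 0) = 2 * r := by
    rw [dist_plane]
    simp only [halfRegularVertices_zero, halfRegularVertices_one, Fin.val_last, Fin.val_zero]
    rw [show (N : ℝ) * Real.pi / N = Real.pi by field_simp]
    simp only [Nat.cast_zero, zero_mul, zero_div, Real.cos_pi, Real.sin_pi, Real.cos_zero,
      Real.sin_zero]
    rw [← Real.sqrt_sq (show 0 ≤ 2 * r by positivity)]
    congr 1; ring
  rw [perimeter_eq, Fin.sum_univ_castSucc, Fin.last_add_one, hdiam, Finset.sum_congr rfl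
    (fun i _ => hside i), Finset.sum_const, Finset.card_univ, Fintype.card_fin, nsmul_eq_mul]
  ring

/-- The origin is the midpoint of the diameter. -/
lemma zero_mem_polygonalChain_halfRegularVertices (hN : 0 < N) (r : ℝ) :
    (0 : Plane) ∈ polygonalChain (halfRegularVertices (N + 1) r) := by
  have hN0 : (0 : ℝ) < N := by exact_mod_cast hN
  rw [polygonalChain_eq]
  refine Set.mem_iUnion.2 ⟨Fin.last N, 1 / 2, 1 / 2, by norm_num, by norm_num, by norm_num, ?_⟩
  rw [Fin.last_add_one]
  have hp : (N : ℝ) * Real.pi / N = Real.pi := by field_simp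
  ext i
  fin_cases i
  · simp [halfRegularVertices_zero, hp]
  · simp [halfRegularVertices_one, hp]

end HalfRegular

/-! ### The relative Chebyshev radius -/

section Chain

variable {N : ℕ}

lemma polygonalChain_subset_of_convex {v : Fin (N + 1) → Plane} {K : Set Plane} (hK : Convex ℝ K)
    (h : ∀ i, v i ∈ K) : polygonalChain v ⊆ K := by
  rw [polygonalChain_eq]
  exact Set.iUnion_subset fun i => hK.segment_subset (h _) (h _)

lemma mem_polygonalChain (v : Fin (N + 1) → Plane) (i : Fin (N + 1)) : v i ∈ polygonalChain v := by
  rw [polygonalChain_eq]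
  exact Set.mem_iUnion.2 ⟨i, left_mem_segment ℝ _ _⟩

lemma isCompact_polygonalChain (v : Fin (N + 1) → Plane) : IsCompact (polygonalChain v) := by
  rw [polygonalChain_eq]
  refine isCompact_iUnion fun i => ?_
  rw [segment_eq_image_lineMap]
  exact isCompact_Icc.image (AffineMap.lineMap_continuous)

end Chain

section Chebyshev

variable {α β : Type*} [MetricSpace α] [MetricSpace β]

lemma bddAbove_range_dist {X : Set α} (hX : Bornology.IsBounded X) (p : X) :
    BddAbove (Set.range fun q : X => dist (p : α) (q : α)) := by
  obtain ⟨C, hC⟩ := Metric.isBounded_iff.1 hX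
  exact ⟨C, by rintro _ ⟨q, rfl⟩; exact hC p.2 q.2⟩

lemma bddBelow_range_iSup_dist (X : Set α) :
    BddBelow (Set.range fun p : X => ⨆ q : X, dist (p : α) (q : α)) :=
  ⟨0, by rintro _ ⟨p, rfl⟩; exact Real.iSup_nonneg fun _ => dist_nonneg⟩

lemma relChebyshevRadius_le {X : Set α} {p : α} (hp : p ∈ X) {r : ℝ} (h : ∀ q ∈ X, dist p q ≤ r) :
    relChebyshevRadius X ≤ r := by
  have : Nonempty X := ⟨⟨p, hp⟩⟩
  exact (ciInf_le (bddBelow_range_iSup_dist X) ⟨p, hp⟩).trans (ciSup_le fun q => h q q.2)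

/-- A compact set has a relative Chebyshev centre. -/
lemma exists_dist_le_relChebyshevRadius {X : Set α} (hX : IsCompact X) (hne : X.Nonempty) :
    ∃ p ∈ X, ∀ q ∈ X, dist p q ≤ relChebyshevRadius X := by
  have : Nonempty X := hne.to_subtype
  have : CompactSpace X := isCompact_iff_compactSpace.1 hX
  have hb := bddAbove_range_dist hX.isBounded
  have hlip : LipschitzWith 1 fun p : X => ⨆ q : X, dist (p : α) (q : α) := by
    refine LipschitzWith.of_le_add fun p p' => ciSup_le fun q => ?_
    calc dist (p : α) q ≤ dist (p : α) p' + dist (p' : α) q := dist_triangle _ _ _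
      _ ≤ dist p p' + ⨆ q : X, dist (p' : α) (q : α) := add_le_add le_rfl (le_ciSup (hb p') q)
      _ = _ := add_comm _ _
  obtain ⟨p, -, hp⟩ := isCompact_univ.exists_isMinOn (Set.univ_nonempty (α := X))
    hlip.continuous.continuousOn
  refine ⟨p, p.2, fun q hq => (le_ciSup (hb p) ⟨q, hq⟩).trans (le_ciInf fun p' => ?_)⟩
  exact hp (Set.mem_univ p')

lemma relChebyshevRadius_image (f : α ≃ᵢ β) (X : Set α) :
    relChebyshevRadius (f '' X) = relChebyshevRadius X := by
  unfold relChebyshevRadius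
  let e : X ≃ f '' X := f.toEquiv.image X
  have he : ∀ p : X, ((e p : f '' X) : β) = f p := fun _ => rfl
  rw [← e.iInf_comp]
  refine iInf_congr fun p => ?_
  rw [← e.iSup_comp]
  refine iSup_congr fun q => ?_
  rw [he, he, f.dist_eq]

end Chebyshev

/-! ### The perimeter as a measure -/

section Hausdorff

open MeasureTheory

variable {N : ℕ} {v : Fin (N + 1) → Plane}

/-- Two different sides of a convex polygon with at least three vertices meet at most in
vertices. -/
lemma IsConvexNgon.segment_inter_subset (hN : 1 < N) (hv : IsConvexNgon v) {i j : Fin (N + 1)}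
    (hij : i ≠ j) : segment ℝ (v i) (v (i + 1)) ∩ segment ℝ (v j) (v (j + 1)) ⊆
      {v i, v (i + 1)} := by
  rintro q ⟨⟨a, b, ha, hb, hab, hq⟩, hqj⟩
  obtain ⟨s, -, hs⟩ := hv.exists_orientation (by omega)
  set g : Plane → ℝ := fun p => s * planeCross (v (j + 1) - v j) (p - v j) with hg
  have hlin : ∀ (a b : ℝ) (p p' : Plane), a + b = 1 → g (a • p + b • p') = a * g p + b * g p' := by
    intro a b p p' h
    obtain rfl : a = 1 - b := by linarith
    simp [hg, planeCross]; ring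
  have h0 : g (v j) = 0 := by simp [hg, planeCross]
  have h1 : g (v (j + 1)) = 0 := by simp [hg, planeCross_self]
  have hgpos : ∀ k, k ≠ j → k ≠ j + 1 → 0 < g (v k) := hs j
  have hgnn : ∀ k, 0 ≤ g (v k) := by
    intro k
    rcases eq_or_ne k j with rfl | h2
    · exact h0.ge
    rcases eq_or_ne k (j + 1) with rfl | h3
    · exact h1.ge
    exact (hgpos k h2 h3).le
  have hq0 : g q = 0 := by
    obtain ⟨c, d, -, -, hcd, rfl⟩ := hqj
    rw [hlin c d _ _ hcd, h0, h1]; ring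
  rw [← hq, hlin a b _ _ hab] at hq0
  have e1 := mul_nonneg ha (hgnn i)
  have e2 := mul_nonneg hb (hgnn (i + 1))
  by_cases hi : i = j + 1
  · have h4 := hgpos (i + 1) (by rw [hi]; exact fin_add_two_ne hN j)
      (by rw [hi]; exact (fin_ne_add_one (by omega) _).symm)
    have hb0 : b = 0 := (mul_eq_zero.1 (by linarith : b * g (v (i + 1)) = 0)).resolve_right h4.ne'
    left
    rw [← hq, hb0, show a = 1 by linarith]; simp
  · have h4 := hgpos i hij hi
    have ha0 : a = 0 := (mul_eq_zero.1 (by linarith : a * g (v i) = 0)).resolve_right h4.ne'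
    right
    rw [Set.mem_singleton_iff, ← hq, ha0, show b = 1 by linarith]; simp

/-- The perimeter of a convex polygon is the one-dimensional measure of its boundary, with
multiplicity `2` for a doubly covered segment. In particular it only depends on the point set. -/
lemma IsConvexNgon.perimeter_eq_hausdorffMeasure (hN : 0 < N) (hv : IsConvexNgon v) :
    perimeter v = (if N = 1 then 2 else 1) * (μH[1] (polygonalChain v)).toReal := by
  rw [polygonalChain_eq, perimeter_eq]
  split_ifs with h
  · subst h
    have : (⋃ i : Fin 2, segment ℝ (v i) (v (i + 1))) = segment ℝ (v 0) (v 1) := by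
      ext q
      simp only [Set.mem_iUnion, Fin.exists_fin_two, zero_add]
      rw [show (1 + 1 : Fin 2) = 0 from rfl, segment_symm ℝ (v 1), or_self]
    rw [this, hausdorffMeasure_segment, Fin.sum_univ_two, edist_dist,
      ENNReal.toReal_ofReal dist_nonneg, zero_add, show (1 + 1 : Fin 2) = 0 from rfl,
      dist_comm (v 1)]
    ring
  · have : NullSingletonClass (μH[1] : Measure Plane) :=
      Measure.nullSingletonClass_hausdorff Plane one_pos
    rw [measure_iUnion₀]
    · simp only [hausdorffMeasure_segment, edist_dist, tsum_fintype, one_mul]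
      rw [ENNReal.toReal_sum fun _ _ => ENNReal.ofReal_ne_top]
      simp only [ENNReal.toReal_ofReal dist_nonneg]
    · intro i j hij
      exact measure_mono_null (hv.segment_inter_subset (by omega) hij)
        ((Set.toFinite _).measure_zero _)
    · intro i
      have hc : IsCompact (segment ℝ (v i) (v (i + 1))) := by
        rw [segment_eq_image_lineMap]
        exact isCompact_Icc.image (AffineMap.lineMap_continuous)
      exact hc.measurableSet.nullMeasurableSet

lemma IsConvexNgon.perimeter_eq_of_image (hN : 0 < N) {w : Fin (N + 1) → Plane}
    (hv : IsConvexNgon v) (hw : IsConvexNgon w) (f : Plane ≃ᵢ Plane)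
    (h : polygonalChain v = f '' polygonalChain w) : perimeter v = perimeter w := by
  rw [hv.perimeter_eq_hausdorffMeasure hN, hw.perimeter_eq_hausdorffMeasure hN, h,
    f.hausdorffMeasure_image]

end Hausdorff

/-! ### The inequality -/

/-- The isometry of the plane that takes the origin to `p` and the coordinate axes to the
directions `(c, d)` and `s (-d, c)`, where `(c, d)` is a unit vector and `s` is a sign. -/
noncomputable def planeFrame (p : Plane) (c d s : ℝ) (hcd : c ^ 2 + d ^ 2 = 1) (hs : s ^ 2 = 1) :
    Plane ≃ᵢ Plane where
  toFun z := !₂[p 0 + c * z 0 - s * d * z 1, p 1 + d * z 0 + s * c * z 1]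
  invFun q := !₂[c * (q 0 - p 0) + d * (q 1 - p 1), s * (c * (q 1 - p 1) - d * (q 0 - p 0))]
  left_inv z := by
    ext i
    fin_cases i
    · simp; linear_combination z 0 * hcd
    · simp; linear_combination z 1 * (s ^ 2 * hcd + hs)
  right_inv q := by
    ext i
    fin_cases i
    · simp
      linear_combination (q 0 - p 0) * (d ^ 2 * hs + hcd) - d * c * (q 1 - p 1) * hs
    · simp
      linear_combination (q 1 - p 1) * (c ^ 2 * hs + hcd) - d * c * (q 0 - p 0) * hs
  isometry_toFun := by
    refine Isometry.of_dist_eq fun z w => ?_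
    rw [dist_plane, dist_plane]
    congr 1
    simp
    linear_combination ((z 0 - w 0) ^ 2 + s ^ 2 * (z 1 - w 1) ^ 2) * hcd + (z 1 - w 1) ^ 2 * hs

section Polygon

variable {N : ℕ}

lemma polygonalChain_comp_isometryEquiv (f : Plane ≃ᵢ Plane) (v : Fin (N + 1) → Plane) :
    polygonalChain (f ∘ v) = f '' polygonalChain v := by
  rw [polygonalChain_eq, polygonalChain_eq, Set.image_iUnion]
  refine Set.iUnion_congr fun i => ?_
  have h := image_segment ℝ f.toRealAffineIsometryEquiv.toAffineEquiv.toAffineMap (v i) (v (i + 1))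
  exact h.symm

lemma polygonalChain_comp_add_left (v : Fin (N + 1) → Plane) (k : Fin (N + 1)) :
    polygonalChain (fun i => v (k + i)) = polygonalChain v := by
  rw [polygonalChain_eq, polygonalChain_eq]
  simp only [← add_assoc]
  exact (Equiv.addLeft k).surjective.iUnion_comp fun i => segment ℝ (v i) (v (i + 1))

lemma fin_ofNat_add_one (i : ℕ) : Fin.ofNat (N + 1) (i + 1) = Fin.ofNat (N + 1) i + 1 := by
  apply Fin.ext
  rw [Fin.val_add]
  simp [Fin.ofNat]

lemma fin_ofNat_self : Fin.ofNat (N + 1) N = Fin.last N := by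
  apply Fin.ext
  simp [Fin.ofNat]

lemma perimeter_eq_sum_range (v : Fin (N + 1) → Plane) (k : Fin (N + 1)) :
    perimeter v = ∑ i ∈ Finset.range (N + 1),
      dist (v (k + Fin.ofNat (N + 1) i)) (v (k + Fin.ofNat (N + 1) (i + 1))) := by
  rw [perimeter_eq, ← Equiv.sum_comp (Equiv.addLeft k), Finset.sum_range]
  refine Finset.sum_congr rfl fun i _ => ?_
  rw [fin_ofNat_add_one, Fin.ofNat_val_eq_self, Equiv.coe_addLeft, add_assoc]

/-- The inequality, and the description of the polygons for which it is an equality. -/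
lemma IsConvexNgon.perimeter_le (hN : 0 < N) {v : Fin (N + 1) → Plane} (hv : IsConvexNgon v) :
    perimeter v ≤ 2 * (1 + N * Real.sin (Real.pi / (2 * N))) *
        relChebyshevRadius (polygonalChain v) ∧
      (perimeter v = 2 * (1 + N * Real.sin (Real.pi / (2 * N))) *
          relChebyshevRadius (polygonalChain v) →
        ∃ r : ℝ, 0 < r ∧ ∃ f : Plane ≃ᵢ Plane,
          polygonalChain v = f '' polygonalChain (halfRegularVertices (N + 1) r)) := by
  obtain ⟨p, hpX, hp⟩ := exists_dist_le_relChebyshevRadius (isCompact_polygonalChain v)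
    ⟨v 0, mem_polygonalChain v 0⟩
  set r := relChebyshevRadius (polygonalChain v)
  have hr : 0 ≤ r := dist_nonneg.trans (hp p hpX)
  rw [polygonalChain_eq] at hpX
  obtain ⟨k, hk⟩ := Set.mem_iUnion.1 hpX
  obtain ⟨s, hs, hpos⟩ := hv.exists_orientation hN
  have hs2 : s ^ 2 = 1 := by rcases hs with h | h <;> rw [h] <;> norm_num
  have hne : v k ≠ v (k + 1) := fun h => fin_ne_add_one hN k (hv.injective h)
  -- The frame with origin `p` whose first axis is the direction of the side containing `p`.
  set L := dist (v k) (v (k + 1)) with hL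
  have hLpos : 0 < L := dist_pos.2 hne
  have hL2 : L ^ 2 = (v (k + 1) 0 - v k 0) ^ 2 + (v (k + 1) 1 - v k 1) ^ 2 := by
    rw [hL, dist_comm, dist_plane, Real.sq_sqrt (by positivity)]
  set c := (v (k + 1) 0 - v k 0) / L with hc
  set d := (v (k + 1) 1 - v k 1) / L with hd
  have hcL : v (k + 1) 0 - v k 0 = c * L := by rw [hc]; field_simp
  have hdL : v (k + 1) 1 - v k 1 = d * L := by rw [hd]; field_simp
  have hcd : c ^ 2 + d ^ 2 = 1 := by
    rw [hc, hd, div_pow, div_pow, ← add_div, ← hL2]; field_simp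
  set F := planeFrame p c d s hcd hs2 with hF
  have hG0 : ∀ q, F.symm q 0 = c * (q 0 - p 0) + d * (q 1 - p 1) := fun _ => rfl
  have hG1 : ∀ q, F.symm q 1 = s * (c * (q 1 - p 1) - d * (q 0 - p 0)) := fun _ => rfl
  have hdist : ∀ q q', dist q q' =
      √((F.symm q 0 - F.symm q' 0) ^ 2 + (F.symm q 1 - F.symm q' 1) ^ 2) := fun q q' => by
    rw [← dist_plane, F.symm.dist_eq]
  have hcross : ∀ q q' q'', (F.symm q' 0 - F.symm q 0) * (F.symm q'' 1 - F.symm q 1) -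
      (F.symm q' 1 - F.symm q 1) * (F.symm q'' 0 - F.symm q 0) =
      s * planeCross (q' - q) (q'' - q) := by
    intro q q' q''
    simp only [hG0, hG1, planeCross, PiLp.sub_apply]
    linear_combination (s * ((q' 0 - q 0) * (q'' 1 - q 1) - (q' 1 - q 1) * (q'' 0 - q 0))) * hcd
  -- Numbering of the vertices that starts after the side containing `p`.
  set σ : ℕ → Fin (N + 1) := fun i => k + 1 + Fin.ofNat (N + 1) i with hσ
  have hσ0 : σ 0 = k + 1 := by simp [hσ]
  have hσN : σ N = k := by
    simp only [hσ]
    rw [fin_ofNat_self, add_assoc, add_comm 1, Fin.last_add_one, add_zero]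
  have hσs : ∀ i, σ (i + 1) = σ i + 1 := fun i => by
    simp only [hσ]; rw [fin_ofNat_add_one]; exact (add_assoc _ _ _).symm
  have hσinj : ∀ {i j}, i ≤ N → j ≤ N → σ i = σ j → i = j := by
    intro i j hi hj h
    have h1 := congrArg Fin.val (add_left_cancel h)
    rwa [Fin.val_ofNat, Fin.val_ofNat, Nat.mod_eq_of_lt (by omega),
      Nat.mod_eq_of_lt (by omega)] at h1
  have hline : planeCross (v (k + 1) - v k) (v k - p) = 0 := by
    obtain ⟨a, b, -, -, hab, rfl⟩ := hk
    obtain rfl : a = 1 - b := by linarith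
    simp [planeCross]; ring
  have hheight : ∀ q, L * F.symm q 1 = s * planeCross (v (k + 1) - v k) (q - v k) := by
    intro q
    rw [hG1]
    simp only [planeCross, PiLp.sub_apply, hcL, hdL] at hline ⊢
    linear_combination s * hline
  have hy0 : F.symm (v (σ 0)) 1 = 0 := by
    have := hheight (v (σ 0))
    rw [hσ0, planeCross_self, mul_zero] at this
    rw [hσ0]
    exact (mul_eq_zero.1 this).resolve_left hLpos.ne'
  have hyN : F.symm (v (σ N)) 1 = 0 := by
    have := hheight (v (σ N))
    rw [hσN, sub_self, show planeCross (v (k + 1) - v k) 0 = 0 by simp [planeCross],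
      mul_zero] at this
    rw [hσN]
    exact (mul_eq_zero.1 this).resolve_left hLpos.ne'
  have hdiam : dist (v (σ N)) (v (σ (N + 1))) = F.symm (v (σ 0)) 0 - F.symm (v (σ N)) 0 := by
    rw [hσs, hσN, hσ0, ← hL, hG0, hG0]
    have : L = c * (c * L) + d * (d * L) := by linear_combination (-L) * hcd
    rw [← hcL, ← hdL] at this
    linear_combination this
  have hperi : perimeter v = F.symm (v (σ 0)) 0 - F.symm (v (σ N)) 0 + ∑ i ∈ Finset.range N,
      √((F.symm (v (σ (i + 1))) 0 - F.symm (v (σ i)) 0) ^ 2 +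
        (F.symm (v (σ (i + 1))) 1 - F.symm (v (σ i)) 1) ^ 2) := by
    rw [perimeter_eq_sum_range v (k + 1), Finset.sum_range_succ, add_comm]
    refine congrArg₂ _ hdiam (Finset.sum_congr rfl fun i _ => ?_)
    rw [dist_comm, hdist]
  obtain ⟨hle, heq⟩ := halfDisc_convex_chain_le hN hr (x := fun i => F.symm (v (σ i)) 0)
    (y := fun i => F.symm (v (σ i)) 1)
    (by
      intro i _
      have h1 := hp _ (mem_polygonalChain v (σ i))
      rw [dist_comm, hdist, show F.symm p 0 = 0 by simp [hG0], show F.symm p 1 = 0 by simp [hG1],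
        sub_zero, sub_zero] at h1
      exact (Real.sqrt_le_left hr).1 h1)
    (by
      intro i h0 hi
      have h1 := hpos k (σ i) (fun h => hi.ne (hσinj hi.le le_rfl (h.trans hσN.symm)))
        (fun h => h0.ne' (hσinj hi.le (Nat.zero_le _) (h.trans hσ0.symm)))
      rw [← hheight] at h1
      exact pos_of_mul_pos_right h1 hLpos.le)
    hy0 hyN
    (by
      intro i hi
      rw [hcross, hσs i]
      refine hpos _ _ (fun h => ?_) (fun h => ?_)
      · have := hσinj hi (by omega) h; omega
      · have := hσinj hi (by omega : i + 1 ≤ N) (h.trans (hσs i).symm); omega)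
    (by
      intro i hi
      rw [hcross, hσs i]
      rcases Nat.eq_zero_or_pos i with rfl | h0
      · simp [planeCross]
      · refine (hpos _ _ (fun h => ?_) (fun h => ?_)).le
        · have := hσinj (Nat.zero_le _) hi.le h; omega
        · have := hσinj (Nat.zero_le _) hi (h.trans (hσs i).symm); omega)
  rw [← hperi] at hle heq
  refine ⟨hle, fun h => ?_⟩
  have hr0 : 0 < r := by
    refine hr.lt_of_ne fun h0 => hne ?_
    have h1 := hp _ (mem_polygonalChain v k)
    have h2 := hp _ (mem_polygonalChain v (k + 1))
    rw [← h0, dist_le_zero] at h1 h2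
    exact h1.symm.trans h2
  refine ⟨r, hr0, F, ?_⟩
  rw [← polygonalChain_comp_isometryEquiv, ← polygonalChain_comp_add_left v (k + 1)]
  congr 1
  funext i
  obtain ⟨h1, h2⟩ := heq hr0 h i (Nat.lt_succ_iff.1 i.2)
  rw [Function.comp_apply, ← F.symm_apply_eq]
  have hi : σ i = k + 1 + i := by simp only [hσ]; rw [Fin.ofNat_val_eq_self]
  rw [hi] at h1 h2
  ext j
  fin_cases j
  · exact h1.trans (halfRegularVertices_zero r i).symm
  · exact h2.trans (halfRegularVertices_one r i).symm

lemma relChebyshevRadius_halfRegularVertices (hN : 0 < N) {r : ℝ} (hr : 0 < r) :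
    relChebyshevRadius (polygonalChain (halfRegularVertices (N + 1) r)) = r := by
  apply le_antisymm
  · refine relChebyshevRadius_le (zero_mem_polygonalChain_halfRegularVertices hN r) fun q hq => ?_
    have := polygonalChain_subset_of_convex (convex_closedBall (0 : Plane) r)
      (fun i => by simp [norm_halfRegularVertices hr i]) hq
    rw [dist_comm]
    exact this
  -- The inequality for the polygon itself bounds its radius from below.
  · have h := ((isConvexNgon_halfRegularVertices hN hr).perimeter_le hN).1
    rw [perimeter_halfRegularVertices hN hr] at h
    have hs : 0 ≤ Real.sin (Real.pi / (2 * N)) := sin_pi_div_two_mul_nonneg hN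
    exact le_of_mul_le_mul_left h (by positivity)

end Polygon

theorem theorem4 (n : ℕ) (hn : 2 ≤ n) :
    (∀ v : Fin n → Plane, IsConvexNgon v →
      perimeter v ≤ 2 * (1 + ((n : ℝ) - 1) * Real.sin (Real.pi / (2 * ((n : ℝ) - 1)))) *
          relChebyshevRadius (polygonalChain v) ∧
      (perimeter v = 2 * (1 + ((n : ℝ) - 1) * Real.sin (Real.pi / (2 * ((n : ℝ) - 1)))) *
          relChebyshevRadius (polygonalChain v) ↔
        ∃ r : ℝ, 0 < r ∧ ∃ f : Plane ≃ᵢ Plane,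
          polygonalChain v = f '' polygonalChain (halfRegularVertices n r))) ∧
    (∀ r : ℝ, 0 < r → IsConvexNgon (halfRegularVertices n r)) := by
  obtain ⟨N, rfl⟩ : ∃ N, n = N + 1 := ⟨n - 1, by omega⟩
  have hN : 0 < N := by omega
  rw [show ((N + 1 : ℕ) : ℝ) - 1 = N by push_cast; ring]
  refine ⟨fun v hv => ?_, fun r hr => isConvexNgon_halfRegularVertices hN hr⟩
  obtain ⟨hle, heq⟩ := hv.perimeter_le hN
  refine ⟨hle, heq, ?_⟩
  rintro ⟨r, hr, f, hf⟩
  rw [hv.perimeter_eq_of_image hN (isConvexNgon_halfRegularVertices hN hr) f hf,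
    perimeter_halfRegularVertices hN hr, hf, relChebyshevRadius_image,
    relChebyshevRadius_halfRegularVertices hN hr]
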